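/- Let $(X,d)$ be a complete metric space, $\lambda\in\mathbb R$, and let $\phi:X\to(-\infty,\infty]$ be lower semi-continuous with $D(\phi):=\{\phi<\infty\}\neq\emptyset$. A minimal geodesic is a curve $\gamma:[0,1]\to X$ with $d(\gamma(s),\gamma(t))=|s-t|\,d(\gamma(0),\gamma(1))$ for all $s,t\in[0,1]$. We say that $\phi$ is $\lambda$-convex along $\gamma$ if $\phi(\gamma(t))\le(1-t)\phi(\gamma(0))+t\phi(\gamma(1))-\frac{\lambda}{2}(1-t)t\,d^2(\gamma(0),\gamma(1))$ for all $t\in[0,1]$. For $\tau>0$ and $x\in X$ put $\phi_\tau(x):=\inf_{z\in X}\{\phi(z)+\frac{d^2(x,z)}{2\tau}\}$ and let $J_\tau(x)$ be the set of points $z$ attaining this infimum. Assume one of the following. (I) $(X,d)$ is a (geodesic) $\mathrm{CAT}(1)$-space, and any $x,y\in D(\phi)$ are joined by some minimal geodesic along which $\phi$ is $\lambda$-convex. (II) $\phi$ is coercive, i.e. there is $\tau_*>0$ such that $\phi_\tau(x)>-\infty$ and $J_\tau(x)\ne\emptyset$ for all $x\in X$ and $\tau\in(0,\tau_*)$; and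 there are $K\in\mathbb R$ and a family $\Gamma$ of minimal geodesics joining any two points of $D(\phi)$ such that: $\phi$ is $\lambda$-convex along every $\gamma\in\Gamma$ with end points in $D(\phi)$; for every $z\in X$ the function $d^2(\cdot,z)$ is $K$-convex along every $\gamma\in\Gamma$; and for all $\gamma,\eta\in\Gamma$ with $\gamma(0)=\eta(0)$ the commutativity $$\lim_{s\downarrow0}\frac{d^2(\gamma(s),\eta(1))-d^2(\gamma(0),\eta(1))}{s}=\lim_{t\downarrow0}\frac{d^2(\eta(t),\gamma(1))-d^2(\eta(0),\gamma(1))}{t}$$ holds. For $x_0\in D(\phi)$, a gradient curve starting from $x_0$ is a curve $\xi:[0,\infty)\to X$ that is the pointwise limit, as $i\to\infty$, of curves $\bar x_i$ of the following form: there are partitions $0=t_i^0<t_i^1<\cdots\to\infty$ with $\sup_k(t_i^k-t_i^{k-1})\to0$ as $i\to\infty$ and points $x_i^0=x_0$, $x_i^k\in J_{t_i^k-t_i^{k-1}}(x_i^{k-1})$, such that $\bar x_i(0)=x_0$ and $\bar x_i(t)=x_i^k$ for $t\in(t_i^{k-1},t_i^k]$. (This is the curve $\xi(t)=\mathcal G(t,x_0)$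 of the gradient flow $\mathcal G$ of $\phi$.) For $x\in D(\phi)$ the local slope is $|\nabla\phi|(x):=\limsup_{y\to x}\frac{\max\{\phi(x)-\phi(y),0\}}{d(x,y)}\in[0,\infty]$, which is $0$ if $x$ is isolated; outside $D(\phi)$ it is set to $\infty$. Let $x_0\in D(\phi)$ and let $\xi$ be a gradient curve starting from $x_0$. (i) (Large time behavior.) If $\phi(\xi(t))$ stays bounded below as $t\to\infty$ (that is, $\lim_{t\to\infty}\phi(\xi(t))>-\infty$), then $\lim_{t\to\infty}|\nabla\phi|(\xi(t))=0$. (ii) If $t_n\to\infty$ and $\xi(t_n)\to\bar x$ for some sequence $(t_n)$ and some $\bar x\in X$, then $\bar x$ is a stationary point, that is, $\bar x\in D(\phi)$, $|\nabla\phi|(\bar x)=0$, and the constant curve $t\mapsto\bar x$ is the unique gradient curve starting from $\bar x$; moreover $\lim_{t\to\infty}\phi(\xi(t))=\phi(\bar x)$. -/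

import Mathlib

open Filter Topology

/-- The effective domain `D(φ)` of `φ : X → (-∞, ∞]`. -/
def effDomain {X : Type*} (φ : X → EReal) : Set X := {x | φ x ≠ ⊤}

/-- `γ`, restricted to `[0,1]`, is a minimal geodesic from `x` to `y` for the distance function
`d`. It is used for metric spaces and for the round sphere with its angular distance. -/
def IsMinimalGeodesic {Y : Type*} (d : Y → Y → ℝ) (γ : ℝ → Y) (x y : Y) : Prop :=
  γ 0 = x ∧ γ 1 = y ∧
    ∀ s ∈ Set.Icc (0 : ℝ) 1, ∀ t ∈ Set.Icc (0 : ℝ) 1, d (γ s) (γ t) = |s - t| * d x y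

/-- The unit sphere `𝕊²` in `ℝ³`. -/
abbrev UnitTwoSphere : Type := Metric.sphere (0 : EuclideanSpace ℝ (Fin 3)) 1

/-- The angular (intrinsic Riemannian) distance of `𝕊²`. -/
noncomputable def sphereDist (u v : UnitTwoSphere) : ℝ :=
  InnerProductGeometry.angle (u : EuclideanSpace ℝ (Fin 3)) (v : EuclideanSpace ℝ (Fin 3))

/-- `CAT(1)`-spaces: geodesic metric spaces in which every triangle `x, y, z` of perimeter less
than `2π` is not thicker than its comparison triangle `x', y', z'` in `𝕊²`. (Comparison triangles
exist and are unique up to rigid motion; all their sides are shorter than `π`.) -/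
def IsCATOne (X : Type*) [MetricSpace X] : Prop :=
  (∀ x y : X, ∃ γ : ℝ → X, IsMinimalGeodesic dist γ x y) ∧
  ∀ (x y z : X) (γ : ℝ → X), dist x y + dist y z + dist z x < 2 * Real.pi →
    IsMinimalGeodesic dist γ y z →
    ∀ (x' y' z' : UnitTwoSphere) (γ' : ℝ → UnitTwoSphere),
      sphereDist x' y' = dist x y → sphereDist y' z' = dist y z → sphereDist z' x' = dist z x →
      IsMinimalGeodesic sphereDist γ' y' z' →
      ∀ t ∈ Set.Icc (0 : ℝ) 1, dist x (γ t) ≤ sphereDist x' (γ' t)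

section Functionals

variable {X : Type*} [MetricSpace X]

/-- The `lam`-convexity inequality for `φ : X → (-∞, ∞]` along `γ : [0,1] → X`, where the two
end points of `γ` are meant to lie in `D(φ)`. -/
def ConvexAlong (φ : X → EReal) (lam : ℝ) (γ : ℝ → X) : Prop :=
  ∀ t ∈ Set.Icc (0 : ℝ) 1,
    φ (γ t) ≤ (((1 - t) * (φ (γ 0)).toReal + t * (φ (γ 1)).toReal
      - lam / 2 * (1 - t) * t * dist (γ 0) (γ 1) ^ 2 : ℝ) : EReal)

/-- `φ` is `lam`-(geodesically) convex: any two points of `D(φ)` are joined by some minimal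
geodesic along which the `lam`-convexity inequality holds. -/
def IsGeodConvex (φ : X → EReal) (lam : ℝ) : Prop :=
  ∀ x ∈ effDomain φ, ∀ y ∈ effDomain φ,
    ∃ γ : ℝ → X, IsMinimalGeodesic dist γ x y ∧ ConvexAlong φ lam γ

/-- `K`-convexity along `γ` of the squared distance function from every point. -/
def SqDistConvexAlong (K : ℝ) (γ : ℝ → X) : Prop :=
  ∀ z : X, ∀ t ∈ Set.Icc (0 : ℝ) 1,
    dist (γ t) z ^ 2 ≤ (1 - t) * dist (γ 0) z ^ 2 + t * dist (γ 1) z ^ 2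
      - K / 2 * (1 - t) * t * dist (γ 0) (γ 1) ^ 2

/-- The commutativity of two geodesics `γ`, `η` issuing from the same point `γ 0 = η 0`:
the derivative at `0` of the squared distance to `η 1` along `γ` and the derivative at `0` of
the squared distance to `γ 1` along `η` exist and agree. -/
def GeodesicsCommute (γ η : ℝ → X) : Prop :=
  ∃ l : ℝ,
    Tendsto (fun s : ℝ => (dist (γ s) (η 1) ^ 2 - dist (γ 0) (η 1) ^ 2) / s)
      (𝓝[>] 0) (𝓝 l) ∧
    Tendsto (fun t : ℝ => (dist (η t) (γ 1) ^ 2 - dist (η 0) (γ 1) ^ 2) / t)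
      (𝓝[>] 0) (𝓝 l)

/-- The Moreau-Yosida approximation `φ_τ(x) = inf_z {φ(z) + d²(x,z)/(2τ)}`. -/
noncomputable def moreauYosida (φ : X → EReal) (τ : ℝ) (x : X) : EReal :=
  ⨅ z : X, φ z + ((dist x z ^ 2 / (2 * τ) : ℝ) : EReal)

/-- The set `J_τ(x)` of the points attaining the infimum in `φ_τ(x)`. -/
def minimizerSet (φ : X → EReal) (τ : ℝ) (x : X) : Set X :=
  {z | φ z + ((dist x z ^ 2 / (2 * τ) : ℝ) : EReal) = moreauYosida φ τ x}

/-- Coercivity: there is a threshold `τ' > 0` such that `φ_τ(x) > -∞` and `J_τ(x) ≠ ∅` for all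
`x ∈ X` and all `τ ∈ (0, τ')`. -/
def IsCoerciveFun (φ : X → EReal) : Prop :=
  ∃ τ' : ℝ, 0 < τ' ∧ ∀ (x : X) (τ : ℝ), 0 < τ → τ < τ' →
    moreauYosida φ τ x ≠ ⊥ ∧ (minimizerSet φ τ x).Nonempty

/-- The descending local slope
`|∇φ|(x) = limsup_{y → x} max{φ(x) - φ(y), 0} / d(x,y) ∈ [0,∞]` for `x ∈ D(φ)`
(it is `0` at isolated points), and `∞` outside of `D(φ)`. -/
noncomputable def localSlope (φ : X → EReal) (x : X) : ENNReal :=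
  open scoped Classical in
  if φ x = ⊤ then ⊤ else limsup (fun y => (φ x - φ y).toENNReal / edist x y) (𝓝[≠] x)

/-- `x` is a discrete solution of the variational scheme with initial point `x₀` associated with
the partition `0 = t 0 < t 1 < ⋯ → ∞` of `[0,∞)`. -/
def IsDiscreteSolution (φ : X → EReal) (x₀ : X) (t : ℕ → ℝ) (x : ℕ → X) : Prop :=
  t 0 = 0 ∧ StrictMono t ∧ Tendsto t atTop atTop ∧
    x 0 = x₀ ∧ ∀ k : ℕ, x (k + 1) ∈ minimizerSet φ (t (k + 1) - t k) (x k)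

/-- The interpolated curve: `x 0` at time `0`, and `x k` at the times in `(t (k - 1), t k]`. -/
noncomputable def interpolatedCurve (t : ℕ → ℝ) (x : ℕ → X) (s : ℝ) : X :=
  x (sInf {k : ℕ | s ≤ t k})

/-- `ξ : [0,∞) → X` is a gradient curve of `φ` starting from `x₀`: it is the pointwise limit of
the interpolated curves of a sequence of discrete solutions starting from `x₀` whose partitions
have mesh tending to `0`. (Only the values of `ξ` on `[0,∞)` matter.) -/
def IsGradientCurve (φ : X → EReal) (x₀ : X) (ξ : ℝ → X) : Prop :=
  ∃ (t : ℕ → ℕ → ℝ) (x : ℕ → ℕ → X),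
    (∀ i, IsDiscreteSolution φ x₀ (t i) (x i)) ∧
    (∀ ε : ℝ, 0 < ε → ∀ᶠ i in atTop, ∀ k, t i (k + 1) - t i k ≤ ε) ∧
    ∀ s : ℝ, 0 ≤ s → Tendsto (fun i => interpolatedCurve (t i) (x i) s) atTop (𝓝 (ξ s))

/-- `x` is a stationary point of the gradient flow of `φ`: it lies in `D(φ)`, and the gradient
curve starting from `x` is constant, i.e. the constant curve is the one and only gradient curve
starting from `x`. -/
def IsStationaryPoint (φ : X → EReal) (x : X) : Prop :=
  x ∈ effDomain φ ∧ IsGradientCurve φ x (fun _ => x) ∧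
    ∀ ζ : ℝ → X, IsGradientCurve φ x ζ → ∀ t : ℝ, 0 ≤ t → ζ t = x

/-- First admissible case: the space is `CAT(1)` and `φ` is `lam`-convex. -/
def CaseCATOne (φ : X → EReal) (lam : ℝ) : Prop :=
  IsCATOne X ∧ IsGeodConvex φ lam

/-- Second admissible case: `φ` is coercive and there is a family `Γ` of minimal geodesics, joining
any two points of `D(φ)`, along which the commutativity, the `K`-convexity of the squared distance
function (for some `K ∈ ℝ`), and the `lam`-convexity of `φ` hold simultaneously. -/
def CaseCommutative (φ : X → EReal) (lam : ℝ) : Prop :=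
  IsCoerciveFun φ ∧ ∃ (K : ℝ) (Γ : Set (ℝ → X)),
    (∀ γ ∈ Γ, IsMinimalGeodesic dist γ (γ 0) (γ 1)) ∧
    (∀ x ∈ effDomain φ, ∀ y ∈ effDomain φ, ∃ γ ∈ Γ, γ 0 = x ∧ γ 1 = y) ∧
    (∀ γ ∈ Γ, ∀ η ∈ Γ, γ 0 = η 0 → GeodesicsCommute γ η) ∧
    (∀ γ ∈ Γ, SqDistConvexAlong K γ) ∧
    (∀ γ ∈ Γ, γ 0 ∈ effDomain φ → γ 1 ∈ effDomain φ → ConvexAlong φ lam γ)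

end Functionals

/-! Both cases lead to one inequality for a minimizing step from `x` to `p`: for nearby `y`,
`d²(p,y) - d²(x,y)` is at most `κ τ d²(p,y) + 2τ (f y - f p) + K d²(x,p)` (`LocalEVI`, with `κ =
|λ|`). It comes from the first variation of the minimized functional along a geodesic from `p` to
`y`. The derivative of `d²(x,·)` that appears is bounded by commutativity and `K`-convexity, or by
spherical comparison.

The errors `K d²(x,p)` sum to at most `2Kε` times the drop of `f`, where `ε` is the mesh. They
vanish in the limit, so a gradient curve satisfies the evolution variational inequality without
error (`IsProxLimit.isEVICurve`). Testing the curve against its own time shifts controls the growth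
of `d(u(s), u(s+η))`. Hence the speed, and with it the slope at time `t`, is controlled by the drop
of `f` over `[t-ℓ, t]` (`IsEVICurve.sub_le`).

If `f` converges along the curve, this drop tends to zero, which is (i). At a limit point `y` the
same bound becomes `lim f - f z ≤ κ/2 d²(y,z)`. Taking `z = y` identifies the limit of `f`, and the
slope at `y` is zero. Convexity makes the bound global, so short steps from `y` cannot move, which
gives stationarity. -/

/-- `p` minimizes `z ↦ f z + d²(x,z)/(2τ)` over `D`. -/
def IsProxStep {X : Type*} [MetricSpace X] (D : Set X) (f : X → ℝ) (τ : ℝ) (x p : X) : Prop :=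
  p ∈ D ∧ ∀ z ∈ D, f p + dist x p ^ 2 / (2 * τ) ≤ f z + dist x z ^ 2 / (2 * τ)

/-- The discrete evolution variational inequality, for test points at distance less than `r`. -/
def LocalEVI {X : Type*} [MetricSpace X] (D : Set X) (f : X → ℝ) (κ K r : ℝ) : Prop :=
  ∀ x ∈ D, ∀ τ : ℝ, 0 < τ → ∀ p, IsProxStep D f τ x p → ∀ y ∈ D,
    dist x y < r → dist p y < r → dist x p < r →
    dist p y ^ 2 - dist x y ^ 2 ≤
      κ * τ * dist p y ^ 2 + 2 * τ * (f y - f p) + K * dist x p ^ 2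

/-- A sequence of minimizing steps at the times `t k`. -/
structure IsProxSequence {X : Type*} [MetricSpace X] (D : Set X) (f : X → ℝ) (t : ℕ → ℝ)
    (x : ℕ → X) : Prop where
  zero : t 0 = 0
  mono : StrictMono t
  tendsto : Tendsto t atTop atTop
  mem : ∀ k, x k ∈ D
  step : ∀ k, IsProxStep D f (t (k + 1) - t k) (x k) (x (k + 1))

/-! ### Discrete solutions: energy estimate and summed variational inequality. -/

section Discrete

variable {X : Type*} [MetricSpace X] {D : Set X} {f : X → ℝ}

theorem IsProxStep.dist_sq_le {τ : ℝ} {x p : X} (hx : x ∈ D) (hτ : 0 < τ)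
    (h : IsProxStep D f τ x p) : dist x p ^ 2 ≤ 2 * τ * (f x - f p) := by
  have h1 := h.2 x hx
  rw [dist_self] at h1
  have h2 : dist x p ^ 2 / (2 * τ) ≤ f x - f p := by
    have : (0 : ℝ) ^ 2 / (2 * τ) = 0 := by simp
    linarith
  rw [div_le_iff₀ (by positivity)] at h2
  linarith

variable {t : ℕ → ℝ} {x : ℕ → X}

theorem IsProxSequence.antitone (h : IsProxSequence D f t x) : Antitone fun k => f (x k) := by
  refine antitone_nat_of_succ_le fun k => ?_
  have hτ : 0 < t (k + 1) - t k := sub_pos.2 (h.mono (Nat.lt_succ_self k))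
  have := (h.step k).dist_sq_le (h.mem k) hτ
  by_contra! hlt
  have : 2 * (t (k + 1) - t k) * (f (x k) - f (x (k + 1))) < 0 :=
    mul_neg_of_pos_of_neg (by positivity) (by linarith)
  nlinarith [sq_nonneg (dist (x k) (x (k + 1)))]

/-- Cauchy–Schwarz in the form `√(TP) + √(τq) ≤ √((T+τ)(P+q))`. It lets the one-step energy estimate
be chained with no loss in the constant. -/
theorem add_sq_le_of_sq_le {A B T P τ q : ℝ} (hT : 0 ≤ T) (hP : 0 ≤ P)
    (hτ : 0 ≤ τ) (hq : 0 ≤ q) (h1 : A ^ 2 ≤ 2 * T * P) (h2 : B ^ 2 ≤ 2 * τ * q) :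
    (A + B) ^ 2 ≤ 2 * (T + τ) * (P + q) := by
  have h3 : A * B ≤ T * q + τ * P := by
    refine abs_le_of_sq_le_sq' ?_ (by positivity) |>.2
    have : A ^ 2 * B ^ 2 ≤ (2 * T * P) * (2 * τ * q) :=
      mul_le_mul h1 h2 (by positivity) (by positivity)
    nlinarith [sq_nonneg (T * q - τ * P)]
  nlinarith

theorem IsProxSequence.dist_sq_le (h : IsProxSequence D f t x) {m n : ℕ} (hmn : m ≤ n) :
    dist (x m) (x n) ^ 2 ≤ 2 * (t n - t m) * (f (x m) - f (x n)) := by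
  induction n, hmn using Nat.le_induction with
  | base => simp
  | succ n hmn ih =>
    have hτ : 0 < t (n + 1) - t n := sub_pos.2 (h.mono (Nat.lt_succ_self n))
    have h1 := (h.step n).dist_sq_le (h.mem n) hτ
    have h2 : 0 ≤ f (x n) - f (x (n + 1)) := sub_nonneg.2 (h.antitone (Nat.le_succ n))
    have h3 : 0 ≤ f (x m) - f (x n) := sub_nonneg.2 (h.antitone hmn)
    have h4 : 0 ≤ t n - t m := sub_nonneg.2 (h.mono.monotone hmn)
    have h5 := add_sq_le_of_sq_le h4 h3 hτ.le h2 ih h1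
    calc dist (x m) (x (n + 1)) ^ 2 ≤ (dist (x m) (x n) + dist (x n) (x (n + 1))) ^ 2 := by
          gcongr; exact dist_triangle _ _ _
      _ ≤ _ := h5
      _ = _ := by ring

/-- Sum of the one-step inequalities. The energy estimate keeps all intermediate points within `R`
of `y`, and turns the quadratic errors into a telescoping sum with the factor `2Kε`. -/
theorem IsProxSequence.evi (h : IsProxSequence D f t x) {κ K r ε R C : ℝ}
    (hE : LocalEVI D f κ K r) (hκ : 0 ≤ κ) (hK : 0 ≤ K) (hε : ∀ k, t (k + 1) - t k ≤ ε)
    {m n : ℕ} (hmn : m ≤ n) (hC : f (x m) - f (x n) ≤ C) {y : X} (hy : y ∈ D)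
    (hR : dist (x m) y + √(2 * C * (t n - t m)) ≤ R) (hRr : R < r) :
    dist (x n) y ^ 2 - dist (x m) y ^ 2 ≤ κ * (t n - t m) * R ^ 2
      + 2 * (t n - t m) * (f y - f (x n)) + 2 * K * ε * (f (x m) - f (x n)) := by
  have hC0 : 0 ≤ C := le_trans (sub_nonneg.2 (h.antitone hmn)) hC
  have hclose : ∀ j k, m ≤ j → j ≤ k → k ≤ n →
      dist (x j) (x k) ≤ √(2 * C * (t n - t m)) := by
    intro j k hj hjk hk
    refine Real.le_sqrt_of_sq_le ((h.dist_sq_le hjk).trans ?_)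
    have a1 := h.antitone hj
    have a2 := h.antitone hk
    have a3 := h.mono.monotone hj
    have a4 := h.mono.monotone hk
    have a5 := h.mono.monotone hjk
    have a6 := h.antitone hjk
    simp only at a1 a2 a6
    have : (t k - t j) * (f (x j) - f (x k)) ≤ (t n - t m) * C :=
      mul_le_mul (by linarith) (by linarith) (by linarith) (by linarith)
    linarith
  have hnear : ∀ k, m ≤ k → k ≤ n → dist (x k) y ≤ R := by
    intro k hk hkn
    have := hclose m k le_rfl hk hkn
    have := dist_triangle (x k) (x m) y
    rw [dist_comm (x k) (x m)] at this
    linarith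
  have key : ∀ k, m ≤ k → k ≤ n → dist (x k) y ^ 2 - dist (x m) y ^ 2 ≤
      κ * (t k - t m) * R ^ 2 + 2 * (t k - t m) * (f y - f (x n))
        + 2 * K * ε * (f (x m) - f (x k)) := by
    intro k hk
    induction k, hk using Nat.le_induction with
    | base => intro _; simp
    | succ k hk ih =>
      intro hkn
      have ih := ih (by omega)
      have hτ : 0 < t (k + 1) - t k := sub_pos.2 (h.mono (Nat.lt_succ_self k))
      have hcl := hclose k (k + 1) hk (by omega) hkn
      have hd := (h.step k).dist_sq_le (h.mem k) hτ
      have h1 := hE (x k) (h.mem k) _ hτ _ (h.step k) y hy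
        ((hnear k hk (by omega)).trans_lt hRr) ((hnear (k + 1) (by omega) hkn).trans_lt hRr)
        (by linarith [dist_nonneg (x := x m) (y := y)])
      have hn1 := hnear (k + 1) (by omega) hkn
      have e1 : κ * (t (k + 1) - t k) * dist (x (k + 1)) y ^ 2
          ≤ κ * (t (k + 1) - t k) * R ^ 2 := by gcongr
      have hf : f (x n) ≤ f (x (k + 1)) := h.antitone hkn
      have e2 : (t (k + 1) - t k) * (f y - f (x (k + 1)))
          ≤ (t (k + 1) - t k) * (f y - f (x n)) := by gcongr
      have hf' : 0 ≤ f (x k) - f (x (k + 1)) := sub_nonneg.2 (h.antitone (Nat.le_succ k))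
      have e3 : K * dist (x k) (x (k + 1)) ^ 2 ≤ K * (2 * ε * (f (x k) - f (x (k + 1)))) := by
        gcongr
        exact hd.trans (by gcongr; exact hε k)
      linarith
  exact key n hmn le_rfl

/-- The index of the first grid point after time `s`. -/
noncomputable def gridIndex (t : ℕ → ℝ) (s : ℝ) : ℕ := sInf {k : ℕ | s ≤ t k}

theorem IsProxSequence.le_gridIndex (h : IsProxSequence D f t x) (s : ℝ) :
    s ≤ t (gridIndex t s) := by
  have : {k : ℕ | s ≤ t k}.Nonempty := (h.tendsto.eventually_ge_atTop s).exists
  exact Nat.sInf_mem this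

theorem IsProxSequence.gridIndex_mono (h : IsProxSequence D f t x) {s s' : ℝ} (hs : s ≤ s') :
    gridIndex t s ≤ gridIndex t s' :=
  Nat.sInf_le (hs.trans (h.le_gridIndex s'))

theorem IsProxSequence.gridIndex_le (h : IsProxSequence D f t x) {s ε : ℝ} (hs : 0 ≤ s)
    (h0 : 0 ≤ ε) (hε : ∀ k, t (k + 1) - t k ≤ ε) : t (gridIndex t s) ≤ s + ε := by
  rcases hk : gridIndex t s with _ | k
  · rw [h.zero]; linarith
  · have : k ∉ {k : ℕ | s ≤ t k} := Nat.notMem_of_lt_sInf (by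
      change k < gridIndex t s; omega)
    simp only [Set.mem_ofPred_eq, not_le] at this
    linarith [hε k]

end Discrete

/-! ### Passage to the limit of vanishing mesh. -/

/-- `u` is the pointwise limit along `l` of prox sequences of vanishing mesh with values of `f`
bounded by `B`. -/
structure IsProxLimit {X : Type*} [MetricSpace X] (D : Set X) (f : X → ℝ) (B : ℝ) (l : Filter ℕ)
    (t : ℕ → ℕ → ℝ) (x : ℕ → ℕ → X) (u : ℝ → X) : Prop where
  seq : ∀ i, IsProxSequence D f (t i) (x i)
  mesh : ∀ ε : ℝ, 0 < ε → ∀ᶠ i in l, ∀ k, t i (k + 1) - t i k ≤ ε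
  le : ∀ i k, f (x i k) ≤ B
  lim : ∀ s : ℝ, 0 ≤ s → Tendsto (fun i => x i (gridIndex (t i) s)) l (𝓝 (u s))

/-- Curves satisfying the energy estimate and the local evolution variational inequality. -/
structure IsEVICurve {X : Type*} [MetricSpace X] (D : Set X) (f : X → ℝ) (B κ r₀ : ℝ)
    (u : ℝ → X) : Prop where
  mem : ∀ s, 0 ≤ s → u s ∈ D
  le : ∀ s, 0 ≤ s → f (u s) ≤ B
  anti : ∀ s t, 0 ≤ s → s ≤ t → f (u t) ≤ f (u s)
  dist_sq_le : ∀ s t, 0 ≤ s → s ≤ t → dist (u s) (u t) ^ 2 ≤ 2 * (t - s) * (f (u s) - f (u t))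
  evi : ∀ s t, 0 ≤ s → s ≤ t → ∀ C R : ℝ, B - f (u t) < C → ∀ y ∈ D,
    dist (u s) y + √(2 * C * (t - s)) < R → R < r₀ →
    dist (u t) y ^ 2 - dist (u s) y ^ 2 ≤ κ * (t - s) * R ^ 2 + 2 * (t - s) * (f y - f (u t))

section Limit

variable {X : Type*} [MetricSpace X] {D : Set X} {f : X → ℝ} {B : ℝ} {l : Filter ℕ}
  {t : ℕ → ℕ → ℝ} {x : ℕ → ℕ → X} {u : ℝ → X}

namespace IsProxLimit

/-- The filter is kept general so that `eventually_le` can restrict to the indices where a bound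
fails. -/
theorem anti_filter (h : IsProxLimit D f B l t x u) {l' : Filter ℕ} (hl : l' ≤ l) :
    IsProxLimit D f B l' t x u :=
  ⟨h.seq, fun ε hε => hl (h.mesh ε hε), h.le, fun s hs => (h.lim s hs).mono_left hl⟩

theorem tendsto_grid (h : IsProxLimit D f B l t x u) {s : ℝ} (hs : 0 ≤ s) :
    Tendsto (fun i => t i (gridIndex (t i) s)) l (𝓝 s) := by
  rw [Metric.tendsto_nhds]
  intro ε hε
  filter_upwards [h.mesh (ε / 2) (by positivity)] with i hi
  have h1 := (h.seq i).le_gridIndex s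
  have h2 := (h.seq i).gridIndex_le hs (by positivity) hi
  rw [Real.dist_eq, abs_lt]
  constructor <;> linarith

/-- Convergence of the discrete energies is not available here; an eventual lower bound `c` at the
final time takes its place. -/
theorem evi_of_eventually_ge [l.NeBot] (h : IsProxLimit D f B l t x u) {κ K r₀ : ℝ}
    (hE : LocalEVI D f κ K r₀) (hκ : 0 ≤ κ) (hK : 0 ≤ K) {s r c C R : ℝ} (hs : 0 ≤ s)
    (hsr : s ≤ r) (hc : ∀ᶠ i in l, c ≤ f (x i (gridIndex (t i) r))) (hC : B - c ≤ C) {y : X}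
    (hy : y ∈ D) (hR : dist (u s) y + √(2 * C * (r - s)) < R) (hRr : R < r₀) :
    dist (u r) y ^ 2 - dist (u s) y ^ 2 ≤ κ * (r - s) * R ^ 2 + 2 * (r - s) * (f y - c) := by
  have hT : Tendsto (fun i => t i (gridIndex (t i) r) - t i (gridIndex (t i) s)) l (𝓝 (r - s)) :=
    (h.tendsto_grid (hs.trans hsr)).sub (h.tendsto_grid hs)
  have hds := (h.lim s hs).dist (tendsto_const_nhds (x := y))
  have hdr := (h.lim r (hs.trans hsr)).dist (tendsto_const_nhds (x := y))
  have hRe : ∀ᶠ i in l, dist (x i (gridIndex (t i) s)) y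
      + √(2 * C * (t i (gridIndex (t i) r) - t i (gridIndex (t i) s))) < R :=
    (hds.add (hT.const_mul (2 * C)).sqrt).eventually_lt_const hR
  have key : ∀ ε : ℝ, 0 < ε → dist (u r) y ^ 2 - dist (u s) y ^ 2 ≤
      κ * (r - s) * R ^ 2 + 2 * (r - s) * (f y - c) + 2 * K * ε * (B - c) := by
    intro ε hε
    refine le_of_tendsto_of_tendsto ((hdr.pow 2).sub (hds.pow 2))
      ((((hT.const_mul κ).mul_const (R ^ 2)).add ((hT.const_mul 2).mul_const (f y - c))).add_const
        (2 * K * ε * (B - c))) ?_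
    filter_upwards [hRe, hc, h.mesh ε hε] with i h1 h2 h3
    have hmn := (h.seq i).gridIndex_mono hsr
    have hle := h.le i (gridIndex (t i) s)
    have h4 := (h.seq i).evi hE hκ hK h3 hmn (by linarith) hy h1.le hRr
    have h5 : 0 ≤ t i (gridIndex (t i) r) - t i (gridIndex (t i) s) :=
      sub_nonneg.2 ((h.seq i).mono.monotone hmn)
    refine h4.trans ?_
    gcongr
  have hlim : Tendsto (fun ε : ℝ => κ * (r - s) * R ^ 2 + 2 * (r - s) * (f y - c)
      + 2 * K * ε * (B - c)) (𝓝[>] 0) (𝓝 (κ * (r - s) * R ^ 2 + 2 * (r - s) * (f y - c)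
      + 2 * K * 0 * (B - c))) :=
    (Continuous.tendsto (by fun_prop) 0).mono_left nhdsWithin_le_nhds
  have := ge_of_tendsto hlim (eventually_nhdsWithin_of_forall fun ε hε => key ε hε)
  simpa using this

theorem mem_and_le [l.NeBot] (h : IsProxLimit D f B l t x u)
    (hcl : ∀ M, IsClosed {z | z ∈ D ∧ f z ≤ M}) {s : ℝ} (hs : 0 ≤ s) :
    u s ∈ D ∧ f (u s) ≤ B :=
  (hcl B).mem_of_tendsto (h.lim s hs) (Eventually.of_forall fun i => ⟨(h.seq i).mem _, h.le i _⟩)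

theorem eventually_ge (h : IsProxLimit D f B l t x u)
    (hcl : ∀ M, IsClosed {z | z ∈ D ∧ f z ≤ M}) {s c : ℝ} (hs : 0 ≤ s)
    (hc : c < f (u s)) : ∀ᶠ i in l, c ≤ f (x i (gridIndex (t i) s)) := by
  have : u s ∉ {z | z ∈ D ∧ f z ≤ c} := fun hh => absurd hh.2 (not_le.2 hc)
  filter_upwards [(h.lim s hs).eventually ((hcl c).isOpen_compl.mem_nhds this)] with i hi
  by_contra! hlt
  exact hi ⟨(h.seq i).mem _, hlt.le⟩

/-- Energies could jump down in the limit, so the upper bound is claimed only after a delay. If they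
stayed above `c` up to `s'`, testing on `[s, s + δ]` with `y = u s` would bound a square by `δ (κR²
+ 2(f (u s) - c))`, which is negative for small `δ`. -/
theorem eventually_le [l.NeBot] (h : IsProxLimit D f B l t x u)
    (hcl : ∀ M, IsClosed {z | z ∈ D ∧ f z ≤ M}) {κ K r₀ : ℝ} (hr : 0 < r₀)
    (hE : LocalEVI D f κ K r₀) (hκ : 0 ≤ κ) (hK : 0 ≤ K) {s s' c : ℝ} (hs : 0 ≤ s)
    (hss : s < s') (hc : f (u s) < c) : ∀ᶠ i in l, f (x i (gridIndex (t i) s')) ≤ c := by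
  by_contra hcon
  rw [not_eventually] at hcon
  let l' := l ⊓ 𝓟 {i | ¬ f (x i (gridIndex (t i) s')) ≤ c}
  have hne : l'.NeBot := frequently_mem_iff_neBot.1 hcon
  have h' : IsProxLimit D f B l' t x u := h.anti_filter inf_le_left
  have hcc : ∀ᶠ i in l', c ≤ f (x i (gridIndex (t i) s')) := by
    filter_upwards [mem_inf_of_right (mem_principal_self _)] with i hi
    exact (not_le.1 hi).le
  have huD := (h.mem_and_le hcl hs).1
  -- The radius `R = 2√(2(B-c)δ) + δ` strictly exceeds the displacement bound and still tends to
  -- `0`.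
  have hex : Tendsto (fun δ : ℝ => κ * (2 * √(2 * (B - c) * δ) + δ) ^ 2 + 2 * (f (u s) - c))
      (𝓝[>] 0) (𝓝 (κ * (2 * √(2 * (B - c) * 0) + 0) ^ 2 + 2 * (f (u s) - c))) :=
    (Continuous.tendsto (by fun_prop) 0).mono_left nhdsWithin_le_nhds
  have hex2 : Tendsto (fun δ : ℝ => 2 * √(2 * (B - c) * δ) + δ)
      (𝓝[>] 0) (𝓝 (2 * √(2 * (B - c) * 0) + 0)) :=
    (Continuous.tendsto (by fun_prop) 0).mono_left nhdsWithin_le_nhds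
  have e1 := hex.eventually_lt_const (show _ < (0 : ℝ) by simp; linarith)
  have e2 := hex2.eventually_lt_const (show _ < r₀ by simpa using hr)
  have e3 : ∀ᶠ δ : ℝ in 𝓝[>] 0, δ ∈ Set.Ioo 0 (s' - s) := Ioo_mem_nhdsGT (by linarith)
  obtain ⟨δ, h1, h2, h3, h4⟩ := (e1.and (e2.and e3)).exists
  have hge : ∀ᶠ i in l', c ≤ f (x i (gridIndex (t i) (s + δ))) := by
    filter_upwards [hcc] with i hi
    exact hi.trans ((h.seq i).antitone ((h.seq i).gridIndex_mono (by linarith)))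
  have := h'.evi_of_eventually_ge hE hκ hK (C := B - c) (R := 2 * √(2 * (B - c) * δ) + δ) hs
    (by linarith : s ≤ s + δ) hge le_rfl huD (by
      rw [dist_self, add_sub_cancel_left]
      linarith [Real.sqrt_nonneg (2 * (B - c) * δ)]) h2
  rw [dist_self, add_sub_cancel_left] at this
  have h5 : δ * (κ * (2 * √(2 * (B - c) * δ) + δ) ^ 2 + 2 * (f (u s) - c)) < 0 :=
    mul_neg_of_pos_of_neg h3 h1
  nlinarith [sq_nonneg (dist (u (s + δ)) (u s))]

theorem dist_sq_le_of_lt [l.NeBot] (h : IsProxLimit D f B l t x u)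
    (hcl : ∀ M, IsClosed {z | z ∈ D ∧ f z ≤ M}) {s r b c : ℝ} (hs : 0 ≤ s)
    (hsr : s ≤ r) (hb : ∀ᶠ i in l, f (x i (gridIndex (t i) s)) ≤ b) (hc : c < f (u r)) :
    dist (u s) (u r) ^ 2 ≤ 2 * (r - s) * (b - c) := by
  have hT : Tendsto (fun i => t i (gridIndex (t i) r) - t i (gridIndex (t i) s)) l (𝓝 (r - s)) :=
    (h.tendsto_grid (hs.trans hsr)).sub (h.tendsto_grid hs)
  refine le_of_tendsto_of_tendsto (((h.lim s hs).dist (h.lim r (hs.trans hsr))).pow 2)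
    ((hT.const_mul 2).mul_const (b - c)) ?_
  filter_upwards [hb, h.eventually_ge hcl (hs.trans hsr) hc] with i h1 h2
  have hmn := (h.seq i).gridIndex_mono hsr
  have h5 : 0 ≤ t i (gridIndex (t i) r) - t i (gridIndex (t i) s) :=
    sub_nonneg.2 ((h.seq i).mono.monotone hmn)
  refine ((h.seq i).dist_sq_le hmn).trans ?_
  gcongr

theorem isEVICurve [l.NeBot] (h : IsProxLimit D f B l t x u)
    (hcl : ∀ M, IsClosed {z | z ∈ D ∧ f z ≤ M}) {κ K r₀ : ℝ} (hr : 0 < r₀)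
    (hE : LocalEVI D f κ K r₀) (hκ : 0 ≤ κ) (hK : 0 ≤ K) : IsEVICurve D f B κ r₀ u := by
  have hanti : ∀ s t, 0 ≤ s → s ≤ t → f (u t) ≤ f (u s) := by
    intro s r hs hsr
    rcases hsr.eq_or_lt with rfl | hsr
    · exact le_rfl
    by_contra! hlt
    obtain ⟨c, hc1, hc2⟩ := exists_between hlt
    obtain ⟨c', hc1', hc2'⟩ := exists_between hc2
    obtain ⟨i, h1, h2⟩ := ((h.eventually_le hcl hr hE hκ hK hs hsr hc1).and
      (h.eventually_ge hcl (hs.trans hsr.le) hc2')).exists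
    linarith
  refine ⟨fun s hs => (h.mem_and_le hcl hs).1, fun s hs => (h.mem_and_le hcl hs).2, hanti,
    fun s r hs hsr => ?_, fun s r hs hsr C R hC y hy hR hRr => ?_⟩
  · rcases hsr.eq_or_lt with rfl | hsr
    · simp
    -- The sharp upper bound on the energy holds only after time `s`. The piece `[s, s']` is
    -- estimated crudely through `B` and disappears as `s'` decreases to `s`.
    have hp : ∀ s', s < s' → s' < r →
        dist (u s) (u r) ≤ √(2 * (s' - s) * (B - (f (u r) - 1)))
          + √(2 * (r - s') * (f (u s) + (s' - s) - (f (u r) - (s' - s)))) := by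
      intro s' h1 h2
      refine (dist_triangle _ (u s') _).trans (add_le_add ?_ ?_)
      · refine Real.le_sqrt_of_sq_le (h.dist_sq_le_of_lt hcl hs h1.le
          (Eventually.of_forall fun i => h.le i _) ?_)
        linarith [hanti s' r (by linarith) h2.le]
      · exact Real.le_sqrt_of_sq_le (h.dist_sq_le_of_lt hcl (by linarith) h2.le
          (h.eventually_le hcl hr hE hκ hK hs h1 (by linarith)) (by linarith))
    have hlim : Tendsto (fun s' : ℝ => √(2 * (s' - s) * (B - (f (u r) - 1)))
          + √(2 * (r - s') * (f (u s) + (s' - s) - (f (u r) - (s' - s))))) (𝓝[>] s)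
        (𝓝 (√(2 * (s - s) * (B - (f (u r) - 1)))
          + √(2 * (r - s) * (f (u s) + (s - s) - (f (u r) - (s - s)))))) :=
      (Continuous.tendsto (by fun_prop) s).mono_left nhdsWithin_le_nhds
    have hfin := ge_of_tendsto hlim (by
      filter_upwards [Ioo_mem_nhdsGT hsr] with s' hs' using hp s' hs'.1 hs'.2)
    simp only [sub_self, mul_zero, zero_mul, Real.sqrt_zero, zero_add, add_zero, sub_zero] at hfin
    have h0 : 0 ≤ 2 * (r - s) * (f (u s) - f (u r)) :=
      mul_nonneg (by linarith) (by linarith [hanti s r hs hsr.le])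
    exact (Real.le_sqrt dist_nonneg h0).1 hfin
  · have key : ∀ c, c < f (u r) → B - c < C → dist (u r) y ^ 2 - dist (u s) y ^ 2 ≤
        κ * (r - s) * R ^ 2 + 2 * (r - s) * (f y - c) := fun c hc hcC =>
      h.evi_of_eventually_ge hE hκ hK hs hsr (h.eventually_ge hcl (hs.trans hsr) hc) hcC.le hy hR
        hRr
    have hlim : Tendsto (fun c : ℝ => κ * (r - s) * R ^ 2 + 2 * (r - s) * (f y - c))
        (𝓝[<] f (u r)) (𝓝 (κ * (r - s) * R ^ 2 + 2 * (r - s) * (f y - f (u r)))) :=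
      (Continuous.tendsto (by fun_prop) _).mono_left nhdsWithin_le_nhds
    refine ge_of_tendsto hlim ?_
    filter_upwards [Ioo_mem_nhdsLT (show B - C < f (u r) by linarith)] with c hc
    exact key c hc.2 (by linarith [hc.1])

end IsProxLimit

end Limit

/-! ### Regularization along curves satisfying the variational inequality. -/

section Curve

variable {X : Type*} [MetricSpace X] {D : Set X} {f : X → ℝ} {B κ r₀ : ℝ} {u : ℝ → X}

namespace IsEVICurve

theorem dist_le_sqrt (h : IsEVICurve D f B κ r₀ u) {s r T C : ℝ} (hs : 0 ≤ s) (hsr : s ≤ r)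
    (hrT : r ≤ T) (hC : B - f (u T) ≤ C) : dist (u s) (u r) ≤ √(2 * C * (r - s)) := by
  refine Real.le_sqrt_of_sq_le ((h.dist_sq_le s r hs hsr).trans ?_)
  have h1 := h.le s hs
  have h2 := h.anti r T (hs.trans hsr) hrT
  have : (r - s) * (f (u s) - f (u r)) ≤ (r - s) * C :=
    mul_le_mul_of_nonneg_left (by linarith) (by linarith)
  linarith

/-- Move one endpoint at a time: test `u` on `[s, s+δ]` against `u (s+η)`, then on `[s+η, s+δ+η]`
against `u (s+δ)`. The mixed distance cancels in the sum, leaving an energy drop that telescopes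
over successive steps. -/
theorem shift_step (h : IsEVICurve D f B κ r₀ u) {s δ η T C F R : ℝ}
    (hs : 0 ≤ s) (hδ : 0 ≤ δ) (hη : 0 ≤ η) (hT : s + δ + η ≤ T) (hC : B - f (u T) < C)
    (hF : dist (u s) (u (s + η)) ≤ F) (hR : F + 2 * √(2 * C * δ) < R) (hRr : R < r₀) :
    dist (u (s + δ)) (u (s + δ + η)) ^ 2 - dist (u s) (u (s + η)) ^ 2 ≤
      2 * κ * δ * R ^ 2 + 2 * δ * (f (u (s + η)) - f (u (s + δ + η))) := by
  have hsq := Real.sqrt_nonneg (2 * C * δ)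
  have h1 := h.anti (s + δ) T (by linarith) (by linarith)
  have h2 := h.anti (s + δ + η) T (by linarith) (by linarith)
  have e1 := h.evi s (s + δ) hs (by linarith) C R (by linarith) (u (s + η))
    (h.mem _ (by linarith)) (by rw [add_sub_cancel_left]; linarith) hRr
  have hd := h.dist_le_sqrt hs (by linarith : s ≤ s + δ) (by linarith : s + δ ≤ T) hC.le
  rw [add_sub_cancel_left] at hd
  have hd' : dist (u (s + η)) (u (s + δ)) ≤ F + √(2 * C * δ) := by
    refine (dist_triangle_left _ _ (u s)).trans (by linarith)
  have e2 := h.evi (s + η) (s + δ + η) (by linarith) (by linarith) C R (by linarith) (u (s + δ))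
    (h.mem _ (by linarith)) (by
      rw [show s + δ + η - (s + η) = δ by ring]; linarith) hRr
  rw [add_sub_cancel_left] at e1
  rw [show s + δ + η - (s + η) = δ by ring, dist_comm (u (s + η)) (u (s + δ)),
    dist_comm (u (s + δ + η))] at e2
  linarith

/-- Over `n + 1` steps of length `δ`, the energy terms telescope to `2δ` times a fixed drop and
vanish as `δ → 0`. -/
theorem shift_le_of_bound (h : IsEVICurve D f B κ r₀ u) {a b η F : ℝ} (ha : 0 ≤ a)
    (hab : a ≤ b) (hη : 0 ≤ η) (hF : ∀ s, a ≤ s → s ≤ b → dist (u s) (u (s + η)) ≤ F)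
    (hFr : F < r₀) :
    dist (u b) (u (b + η)) ^ 2 - dist (u a) (u (a + η)) ^ 2 ≤ 2 * κ * (b - a) * F ^ 2 := by
  set C := B - f (u (b + η)) + 1 with hCdef
  set δ : ℕ → ℝ := fun n => (b - a) / (n + 1) with hδdef
  set R : ℕ → ℝ := fun n => F + 2 * √(2 * C * δ n) + 1 / ((n : ℝ) + 1) with hRdef
  have hone : Tendsto (fun n : ℕ => 1 / ((n : ℝ) + 1)) atTop (𝓝 0) :=
    tendsto_one_div_add_atTop_nhds_zero_nat
  have hδlim : Tendsto δ atTop (𝓝 0) := by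
    have := hone.const_mul (b - a)
    rw [mul_zero] at this
    exact this.congr fun n => by simp [hδdef, div_eq_mul_inv]
  have hRlim : Tendsto R atTop (𝓝 F) := by
    have := ((((hδlim.const_mul (2 * C)).sqrt).const_mul 2).const_add F).add hone
    simpa [hRdef] using this
  have key : ∀ᶠ n in atTop, dist (u b) (u (b + η)) ^ 2 - dist (u a) (u (a + η)) ^ 2 ≤
      2 * κ * (b - a) * R n ^ 2 + 2 * δ n * (f (u (a + η)) - f (u (b + η))) := by
    filter_upwards [hRlim.eventually_lt_const hFr] with n hn
    have hn1 : (0 : ℝ) < n + 1 := by positivity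
    have hδ0 : 0 ≤ δ n := div_nonneg (by linarith) hn1.le
    have hδn : ((n : ℝ) + 1) * δ n = b - a := by simp only [hδdef]; field_simp
    have hR : F + 2 * √(2 * C * δ n) < R n := by
      simp only [hRdef]; linarith [one_div_pos.2 hn1]
    have hk : ∀ k : ℕ, k ≤ n + 1 → dist (u (a + k * δ n)) (u (a + k * δ n + η)) ^ 2
        - dist (u a) (u (a + η)) ^ 2 ≤ 2 * κ * (k * δ n) * R n ^ 2
          + 2 * δ n * (f (u (a + η)) - f (u (a + k * δ n + η))) := by
      intro k
      induction k with
      | zero => intro _; simp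
      | succ k ih =>
        intro hkn
        have ih := ih (by omega)
        have hkn' : (k : ℝ) + 1 ≤ n + 1 := by exact_mod_cast hkn
        have hle : ((k : ℝ) + 1) * δ n ≤ b - a := by rw [← hδn]; gcongr
        have hk0 : 0 ≤ (k : ℝ) * δ n := by positivity
        have := h.shift_step (s := a + k * δ n) (T := b + η) (C := C) (by linarith) hδ0 hη
          (by linarith) (by simp only [hCdef]; linarith)
          (hF _ (by linarith) (by linarith)) hR hn
        have e : a + ((k + 1 : ℕ) : ℝ) * δ n = a + k * δ n + δ n := by push_cast; ring
        rw [e]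
        push_cast
        linarith
    have := hk (n + 1) le_rfl
    push_cast at this
    rw [hδn] at this
    simpa using this
  have hlim := ((hRlim.pow 2).const_mul (2 * κ * (b - a))).add
    ((hδlim.const_mul 2).mul_const (f (u (a + η)) - f (u (b + η))))
  simpa using ge_of_tendsto hlim key

/-- A substitute for Gronwall: with `S` the supremum of the shift distance on `[a, b]`, the previous
bound and `4κ(b-a) ≤ 1` give `S² ≤ d² + S²/2`, where `d` is its value at `a`. -/
theorem shift_sq_le (h : IsEVICurve D f B κ r₀ u) (hκ : 0 ≤ κ) {a b η F₀ : ℝ} (ha : 0 ≤ a)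
    (hab : a ≤ b) (hη : 0 ≤ η) (hκab : 4 * κ * (b - a) ≤ 1)
    (hF : ∀ s, a ≤ s → s ≤ b → dist (u s) (u (s + η)) ≤ F₀) (hFr : F₀ < r₀) :
    dist (u b) (u (b + η)) ^ 2 ≤ 2 * dist (u a) (u (a + η)) ^ 2 := by
  set S : Set ℝ := (fun s => dist (u s) (u (s + η))) '' Set.Icc a b with hS
  have hbdd : BddAbove S := ⟨F₀, by rintro _ ⟨s, hs, rfl⟩; exact hF s hs.1 hs.2⟩
  have hne : S.Nonempty := ⟨_, a, ⟨le_rfl, hab⟩, rfl⟩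
  have hmem : ∀ s, a ≤ s → s ≤ b → dist (u s) (u (s + η)) ≤ sSup S := fun s h1 h2 =>
    le_csSup hbdd ⟨s, ⟨h1, h2⟩, rfl⟩
  have hSr : sSup S < r₀ :=
    (csSup_le hne (by rintro _ ⟨s, hs, rfl⟩; exact hF s hs.1 hs.2)).trans_lt hFr
  have hS0 : 0 ≤ sSup S := dist_nonneg.trans (hmem a le_rfl hab)
  have hall : ∀ b', a ≤ b' → b' ≤ b → dist (u b') (u (b' + η)) ^ 2 ≤
      dist (u a) (u (a + η)) ^ 2 + sSup S ^ 2 / 2 := by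
    intro b' h1 h2
    have := h.shift_le_of_bound ha h1 hη (fun s hs hs' => hmem s hs (hs'.trans h2)) hSr
    have h3 : 4 * κ * (b' - a) ≤ 1 := le_trans (by gcongr) hκab
    have h4 : 4 * κ * (b' - a) * sSup S ^ 2 ≤ 1 * sSup S ^ 2 := by gcongr
    linarith
  have hsup : sSup S ≤ √(dist (u a) (u (a + η)) ^ 2 + sSup S ^ 2 / 2) := by
    refine csSup_le hne ?_
    rintro _ ⟨s, hs, rfl⟩
    exact Real.le_sqrt_of_sq_le (hall s hs.1 hs.2)
  have := (Real.le_sqrt hS0 (by positivity)).1 hsup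
  have := hall b hab le_rfl
  linarith

/-- The last of the `N` steps in `[t-ℓ, t]` is at most `√2` times as long as each earlier one, whose
squared length is at most `2η` times its own drop. Averaging over the `N` steps gives the total
drop. -/
theorem shift_sq_le_drop (h : IsEVICurve D f B κ r₀ u) (hκ : 0 ≤ κ) {t ℓ F₀ : ℝ} {N : ℕ}
    (hN : 0 < N) (hℓ : 0 < ℓ) (hℓκ : 4 * κ * ℓ ≤ 1) (ht : ℓ ≤ t)
    (hF : ∀ s, 0 ≤ s → s ≤ t - ℓ / N → dist (u s) (u (s + ℓ / N)) ≤ F₀) (hFr : F₀ < r₀) :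
    dist (u (t - ℓ / N)) (u t) ^ 2 ≤ 4 * (ℓ / N) ^ 2 / ℓ * (f (u (t - ℓ)) - f (u t)) := by
  set η := ℓ / N with hηdef
  have hN0 : (0 : ℝ) < N := by exact_mod_cast hN
  have hη : 0 < η := by positivity
  have hNη : N * η = ℓ := by simp only [hηdef]; field_simp
  have hj : ∀ j : ℕ, j < N → dist (u (t - η)) (u t) ^ 2 ≤
      4 * η * (f (u (t - (j + 1 : ℕ) * η)) - f (u (t - j * η))) := by
    intro j hjN
    have hj1 : (j : ℝ) + 1 ≤ N := by exact_mod_cast hjN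
    have hj2 : ((j : ℝ) + 1) * η ≤ ℓ := by rw [← hNη]; gcongr
    have hj0 : 0 ≤ (j : ℝ) * η := by positivity
    have e1 := h.shift_sq_le hκ (a := t - η - j * η) (b := t - η) (η := η) (F₀ := F₀)
      (by linarith) (by linarith) hη.le
      (le_trans (by gcongr; linarith) hℓκ)
      (fun s hs hs' => hF s (by linarith) hs') hFr
    have e2 := h.dist_sq_le (t - η - j * η) (t - η - j * η + η) (by linarith) (by linarith)
    rw [sub_add_cancel] at e1
    rw [add_sub_cancel_left] at e2
    have e3 : t - η - j * η + η = t - j * η := by ring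
    have e4 : t - η - j * η = t - (j + 1 : ℕ) * η := by push_cast; ring
    rw [e3, e4] at e1 e2
    linarith
  have hsum := Finset.sum_le_sum fun j (hjm : j ∈ Finset.range N) => hj j (Finset.mem_range.1 hjm)
  rw [Finset.sum_const, Finset.card_range, nsmul_eq_mul, ← Finset.mul_sum,
    Finset.sum_range_sub (fun j : ℕ => f (u (t - j * η))), hNη] at hsum
  simp only [Nat.cast_zero, zero_mul, sub_zero] at hsum
  have e5 : 4 * η ^ 2 / ℓ * (f (u (t - ℓ)) - f (u t))
      = (4 * η * (f (u (t - ℓ)) - f (u t))) / N := by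
    rw [← hNη]; field_simp
  rw [e5, le_div_iff₀ hN0]
  linarith

/-- The regularizing effect: the slope is controlled by the recent drop of `f`. -/
theorem sub_le (h : IsEVICurve D f B κ r₀ u) (hκ : 0 ≤ κ) (hr : 0 < r₀) {t ℓ : ℝ}
    (hℓ : 0 < ℓ) (hℓκ : 4 * κ * ℓ ≤ 1) (ht : ℓ ≤ t) {y : X} (hy : y ∈ D)
    (hyr : dist (u t) y < r₀) :
    f (u t) - f y ≤ 2 * √((f (u (t - ℓ)) - f (u t)) / ℓ) * dist (u t) y
      + κ / 2 * dist (u t) y ^ 2 := by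
  set Δ := f (u (t - ℓ)) - f (u t) with hΔ
  have hΔ0 : 0 ≤ Δ := sub_nonneg.2 (h.anti _ _ (by linarith) (by linarith))
  set q := √(Δ / ℓ) with hq
  have hq0 : 0 ≤ q := Real.sqrt_nonneg _
  have hqq : q ^ 2 = Δ / ℓ := Real.sq_sqrt (by positivity)
  set C := B - f (u t) + 1 with hCdef
  have hC : B - f (u t) < C := by simp only [hCdef]; linarith
  set d := dist (u t) y with hd
  set η : ℕ → ℝ := fun N => ℓ / N with hηdef
  have hηlim : Tendsto η atTop (𝓝 0) := tendsto_const_div_atTop_nhds_zero_nat ℓ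
  set R : ℝ → ℝ := fun e => 2 * e * q + d + √(2 * C * e) + e with hRdef
  have hRlim : Tendsto (fun N => R (η N)) atTop (𝓝 d) := by
    have : Tendsto R (𝓝 0) (𝓝 (R 0)) := Continuous.tendsto (by fun_prop) 0
    simp only [hRdef, mul_zero, zero_mul, Real.sqrt_zero, zero_add, add_zero] at this
    exact this.comp hηlim
  have hsq : Tendsto (fun N => √(2 * C * η N)) atTop (𝓝 0) := by
    simpa using (hηlim.const_mul (2 * C)).sqrt
  have key : ∀ᶠ N in atTop, f (u t) - f y ≤ κ / 2 * R (η N) ^ 2 + 2 * η N * q ^ 2 + 2 * q * d := by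
    filter_upwards [hRlim.eventually_lt_const hyr, hsq.eventually_lt_const hr,
      eventually_gt_atTop 0] with N h1 h2 hN
    have hN0 : (0 : ℝ) < N := by exact_mod_cast hN
    have hη : 0 < η N := by simp only [hηdef]; positivity
    have hηℓ : η N ≤ ℓ := div_le_self hℓ.le (by exact_mod_cast hN)
    have hshift := h.shift_sq_le_drop hκ hN hℓ hℓκ ht (F₀ := √(2 * C * η N))
      (fun s hs hs' => by
        have := h.dist_le_sqrt (T := t) hs (by linarith : s ≤ s + η N)
          (by change s ≤ t - η N at hs'; linarith) hC.le
        rwa [add_sub_cancel_left] at this) h2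
    change dist (u (t - η N)) (u t) ^ 2 ≤ 4 * η N ^ 2 / ℓ * Δ at hshift
    have hD : dist (u (t - η N)) (u t) ≤ 2 * η N * q := by
      refine abs_le_of_sq_le_sq' (hshift.trans (le_of_eq ?_)) (by positivity) |>.2
      rw [mul_pow, hqq]; ring
    have htri : dist (u (t - η N)) y ≤ 2 * η N * q + d :=
      (dist_triangle _ (u t) _).trans (by linarith)
    have hev := h.evi (t - η N) t (by linarith) (by linarith) C (R (η N)) hC y hy (by
      rw [sub_sub_cancel]; simp only [hRdef]; linarith) h1
    rw [sub_sub_cancel] at hev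
    have hsqle : dist (u (t - η N)) y ^ 2 ≤ (2 * η N * q + d) ^ 2 := by gcongr
    -- Expanding `(2ηq + d)²`, the term `d²` cancels against `dist (u t) y ^ 2`, so everything left
    -- carries a factor `η`.
    have : η N * (f (u t) - f y) ≤
        η N * (κ / 2 * R (η N) ^ 2 + 2 * η N * q ^ 2 + 2 * q * d) := by
      nlinarith
    exact le_of_mul_le_mul_left this hη
  have hlim := (((hRlim.pow 2).const_mul (κ / 2)).add
    ((hηlim.const_mul 2).mul_const (q ^ 2))).add_const (2 * q * d)
  have := ge_of_tendsto hlim key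
  simp only [mul_zero, zero_mul, add_zero] at this
  linarith

end IsEVICurve

end Curve

/-! ### First variation and the commutative case. -/

section Variation

variable {X : Type*} [MetricSpace X] {φ : X → EReal}

theorem isProxStep_of_mem_minimizerSet (hbot : ∀ x, φ x ≠ ⊥) {τ : ℝ} {x p : X}
    (hx : x ∈ effDomain φ) (hp : p ∈ minimizerSet φ τ x) :
    IsProxStep (effDomain φ) (fun z => (φ z).toReal) τ x p := by
  have hle : ∀ z, φ p + ((dist x p ^ 2 / (2 * τ) : ℝ) : EReal)
      ≤ φ z + ((dist x z ^ 2 / (2 * τ) : ℝ) : EReal) := fun z => by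
    have hp' : φ p + ((dist x p ^ 2 / (2 * τ) : ℝ) : EReal) = moreauYosida φ τ x := hp
    rw [hp']
    exact iInf_le _ z
  have hreal : ∀ z ∈ effDomain φ, φ z = ((φ z).toReal : EReal) := fun z hz =>
    (EReal.coe_toReal hz (hbot z)).symm
  have hpD : p ∈ effDomain φ := by
    intro htop
    have := hle x
    rw [htop, hreal x hx, EReal.top_add_coe, ← EReal.coe_add] at this
    exact absurd this (not_le.2 (EReal.coe_lt_top _))
  refine ⟨hpD, fun z hz => ?_⟩
  have := hle z
  rw [hreal z hz, hreal p hpD, ← EReal.coe_add, ← EReal.coe_add] at this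
  exact_mod_cast this

theorem ConvexAlong.toReal_le (hbot : ∀ x, φ x ≠ ⊥) {lam : ℝ} {γ : ℝ → X}
    (h : ConvexAlong φ lam γ) {t : ℝ} (ht : t ∈ Set.Icc (0 : ℝ) 1) :
    γ t ∈ effDomain φ ∧ (φ (γ t)).toReal ≤ (1 - t) * (φ (γ 0)).toReal + t * (φ (γ 1)).toReal
      - lam / 2 * (1 - t) * t * dist (γ 0) (γ 1) ^ 2 := by
  have h1 := h t ht
  have h2 : φ (γ t) ≠ ⊤ := (h1.trans_lt (EReal.coe_lt_top _)).ne
  refine ⟨h2, ?_⟩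
  rw [← EReal.coe_toReal h2 (hbot _)] at h1
  exact_mod_cast h1

/-- First variation of the functional minimized by a step, along a geodesic. -/
theorem IsProxStep.variation (hbot : ∀ x, φ x ≠ ⊥) {lam τ L : ℝ} {x p y : X} {η : ℝ → X}
    (hp : IsProxStep (effDomain φ) (fun z => (φ z).toReal) τ x p) (hτ : 0 < τ)
    (h0 : η 0 = p) (h1 : η 1 = y) (hconv : ConvexAlong φ lam η) {G : ℝ → ℝ}
    (hG : ∀ s, 0 < s → s ≤ 1 → dist x (η s) ^ 2 ≤ G s)
    (hL : Tendsto (fun s => (G s - dist x p ^ 2) / s) (𝓝[>] 0) (𝓝 L)) :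
    2 * τ * ((φ p).toReal - (φ y).toReal) + lam * τ * dist p y ^ 2 ≤ L := by
  have hlim : Tendsto (fun s : ℝ => 2 * τ * ((φ p).toReal - (φ y).toReal)
      + lam * τ * (1 - s) * dist p y ^ 2) (𝓝[>] 0) (𝓝 (2 * τ * ((φ p).toReal - (φ y).toReal)
      + lam * τ * (1 - 0) * dist p y ^ 2)) :=
    (Continuous.tendsto (by fun_prop) 0).mono_left nhdsWithin_le_nhds
  rw [sub_zero, mul_one] at hlim
  refine le_of_tendsto_of_tendsto hlim hL ?_
  filter_upwards [Ioo_mem_nhdsGT (zero_lt_one' ℝ)] with s hs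
  obtain ⟨hD, hle⟩ := hconv.toReal_le hbot (t := s) ⟨hs.1.le, hs.2.le⟩
  rw [h0, h1] at hle
  have hmin := hp.2 _ hD
  have hGs := hG s hs.1 hs.2.le
  rw [le_div_iff₀ hs.1]
  have h2 : dist x p ^ 2 / (2 * τ) * (2 * τ) = dist x p ^ 2 := by field_simp
  have h3 : dist x (η s) ^ 2 / (2 * τ) * (2 * τ) = dist x (η s) ^ 2 := by field_simp
  have h4 := mul_le_mul_of_nonneg_right (hmin.trans (add_le_add_left hle _))
    (by positivity : 0 ≤ 2 * τ)
  simp only [add_mul, h2, h3] at h4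
  nlinarith

theorem CaseCommutative.isGeodConvex {lam : ℝ} (h : CaseCommutative φ lam) :
    IsGeodConvex φ lam := by
  obtain ⟨-, K, Γ, hgeo, hjoin, -, -, hconv⟩ := h
  intro x hx y hy
  obtain ⟨γ, hγ, h0, h1⟩ := hjoin x hx y hy
  exact ⟨γ, by simpa only [h0, h1] using hgeo γ hγ,
    hconv γ hγ (by rwa [h0]) (by rwa [h1])⟩

/-- The first variation produces the derivative of `d²(x,·)` towards `y`. Commutativity replaces it
by the derivative of `d²(y,·)` from `p` towards `x`, which `K`-convexity bounds above. -/
theorem CaseCommutative.localEVI (hbot : ∀ x, φ x ≠ ⊥) {lam : ℝ} (h : CaseCommutative φ lam) :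
    ∃ K, 0 ≤ K ∧ LocalEVI (effDomain φ) (fun z => (φ z).toReal) |lam| K 1 := by
  obtain ⟨-, K, Γ, hgeo, hjoin, hcomm, hsq, hconv⟩ := h
  refine ⟨|K| / 2, by positivity, fun x hx τ hτ p hp y hy _ _ _ => ?_⟩
  obtain ⟨γ, hγ, hγ0, hγ1⟩ := hjoin p hp.1 x hx
  obtain ⟨η, hη, hη0, hη1⟩ := hjoin p hp.1 y hy
  obtain ⟨l, hl1, hl2⟩ := hcomm γ hγ η hη (by rw [hγ0, hη0])
  rw [hγ0, hη1] at hl1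
  rw [hη0, hγ1] at hl2
  have hvar := hp.variation hbot hτ hη0 hη1
    (hconv η hη (by rw [hη0]; exact hp.1) (by rwa [hη1]))
    (G := fun s => dist (η s) x ^ 2) (fun s _ _ => by rw [dist_comm])
    (by rwa [dist_comm x p])
  have hl : l ≤ dist x y ^ 2 - dist p y ^ 2 - K / 2 * dist p x ^ 2 := by
    have hlim : Tendsto (fun s : ℝ => dist x y ^ 2 - dist p y ^ 2
        - K / 2 * (1 - s) * dist p x ^ 2) (𝓝[>] 0) (𝓝 (dist x y ^ 2 - dist p y ^ 2
        - K / 2 * (1 - 0) * dist p x ^ 2)) :=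
      (Continuous.tendsto (by fun_prop) 0).mono_left nhdsWithin_le_nhds
    rw [sub_zero, mul_one] at hlim
    refine le_of_tendsto_of_tendsto hl1 hlim ?_
    filter_upwards [Ioo_mem_nhdsGT (zero_lt_one' ℝ)] with s hs
    have := hsq γ hγ y s ⟨hs.1.le, hs.2.le⟩
    rw [hγ0, hγ1] at this
    rw [div_le_iff₀ hs.1]
    nlinarith
  have h1 : -lam * (τ * dist p y ^ 2) ≤ |lam| * (τ * dist p y ^ 2) :=
    mul_le_mul_of_nonneg_right (neg_le_abs lam) (by positivity)
  have h2 : -K * dist p x ^ 2 ≤ |K| * dist p x ^ 2 :=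
    mul_le_mul_of_nonneg_right (neg_le_abs K) (by positivity)
  rw [dist_comm x p]
  linarith

end Variation

/-! ### Spherical comparison and the `CAT(1)` case. -/

section Spherical

/-- The point with coordinates `a, b, c`, on the unit sphere. -/
noncomputable def spherePoint (a b c : ℝ) (h : a ^ 2 + b ^ 2 + c ^ 2 = 1) : UnitTwoSphere :=
  ⟨!₂[a, b, c], by
    rw [mem_sphere_zero_iff_norm, EuclideanSpace.norm_eq, Real.sqrt_eq_one]
    simpa [Fin.sum_univ_three] using h⟩

theorem sphereDist_eq_arccos (u v : UnitTwoSphere) :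
    sphereDist u v = Real.arccos (inner ℝ (u : EuclideanSpace ℝ (Fin 3)) v) := by
  rw [sphereDist, InnerProductGeometry.angle, norm_eq_of_mem_sphere u, norm_eq_of_mem_sphere v]
  simp

theorem sphereDist_spherePoint {a b c a' b' c' : ℝ} (h : a ^ 2 + b ^ 2 + c ^ 2 = 1)
    (h' : a' ^ 2 + b' ^ 2 + c' ^ 2 = 1) :
    sphereDist (spherePoint a b c h) (spherePoint a' b' c' h')
      = Real.arccos (a * a' + b * b' + c * c') := by
  rw [sphereDist_eq_arccos]
  congr 1
  simp [spherePoint, PiLp.inner_apply, Fin.sum_univ_three]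
  ring

theorem arccos_cos_sub {s t : ℝ} (h : |s - t| ≤ Real.pi) :
    Real.arccos (Real.cos s * Real.cos t + Real.sin s * Real.sin t) = |s - t| := by
  rw [← Real.cos_sub, ← Real.cos_abs, Real.arccos_cos (abs_nonneg _) h]

variable {X : Type*} [MetricSpace X]

/-- The comparison triangle in coordinates: the side from `p` to `y` runs along the equator from
`(1,0,0)`, and `x` becomes `(cos a, w, √(sin² a - w²))`, with `w` fixed by the distance `c` to `y`.
-/
theorem IsCATOne.dist_le_arccos (h : IsCATOne X) {x p y : X} {η : ℝ → X}
    (hη : IsMinimalGeodesic dist η p y) (hpy : 0 < dist p y)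
    (hper : dist x p + dist p y + dist y x < 2 * Real.pi) {s : ℝ} (hs : s ∈ Set.Icc (0 : ℝ) 1) :
    dist x (η s) ≤ Real.arccos (Real.cos (dist x p) * Real.cos (s * dist p y)
      + (Real.cos (dist x y) - Real.cos (dist x p) * Real.cos (dist p y)) / Real.sin (dist p y)
        * Real.sin (s * dist p y)) := by
  rw [dist_comm y x] at hper
  have ht1 := dist_triangle x p y
  have ht2 := dist_triangle_left p y x
  have ht3 := dist_triangle_right x p y
  set a := dist x p
  set b := dist p y
  set c := dist x y
  have ha : 0 ≤ a := dist_nonneg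
  have hc : 0 ≤ c := dist_nonneg
  have hsin : 0 < Real.sin b := Real.sin_pos_of_pos_of_lt_pi hpy (by linarith)
  have hsina : 0 ≤ Real.sin a := Real.sin_nonneg_of_nonneg_of_le_pi ha (by linarith)
  set w := (Real.cos c - Real.cos a * Real.cos b) / Real.sin b with hw
  have hwb : w * Real.sin b = Real.cos c - Real.cos a * Real.cos b := by
    rw [hw]; field_simp
  -- The triangle inequalities and the perimeter bound give `cos (a+b) ≤ cos c ≤ cos (a-b)`, that is
  -- `|w| ≤ sin a`; this is why the comparison point exists.
  have hc1 : Real.cos c ≤ Real.cos (a - b) := by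
    rw [← Real.cos_abs (a - b)]
    refine Real.cos_le_cos_of_nonneg_of_le_pi (abs_nonneg _) (by linarith) ?_
    rw [abs_le]; constructor <;> linarith
  have hc2 : Real.cos (a + b) ≤ Real.cos c := by
    rcases le_total (a + b) Real.pi with hab | hab
    · exact Real.cos_le_cos_of_nonneg_of_le_pi hc hab ht1
    · rw [← Real.cos_two_pi_sub (a + b)]
      exact Real.cos_le_cos_of_nonneg_of_le_pi hc (by linarith) (by linarith)
  rw [Real.cos_sub] at hc1
  rw [Real.cos_add] at hc2
  have hw1 : w ≤ Real.sin a := by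
    refine le_of_mul_le_mul_right ?_ hsin
    linarith
  have hw2 : -Real.sin a ≤ w := by
    refine le_of_mul_le_mul_right ?_ hsin
    linarith
  have hw3 : 0 ≤ Real.sin a ^ 2 - w ^ 2 := by nlinarith
  have hX : Real.cos a ^ 2 + w ^ 2 + √(Real.sin a ^ 2 - w ^ 2) ^ 2 = 1 := by
    rw [Real.sq_sqrt hw3]; linarith [Real.sin_sq_add_cos_sq a]
  have hγ : ∀ t : ℝ, Real.cos (t * b) ^ 2 + Real.sin (t * b) ^ 2 + (0 : ℝ) ^ 2 = 1 := fun t => by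
    linarith [Real.sin_sq_add_cos_sq (t * b)]
  have hbπ : b ≤ Real.pi := by linarith
  have hgeo : ∀ s ∈ Set.Icc (0 : ℝ) 1, ∀ t ∈ Set.Icc (0 : ℝ) 1,
      sphereDist (spherePoint _ _ _ (hγ s)) (spherePoint _ _ _ (hγ t)) = |s - t| * b := by
    intro s hs t ht
    have hst : |s * b - t * b| = |s - t| * b := by
      rw [← sub_mul, abs_mul, abs_of_pos hpy]
    have hst1 : |s - t| ≤ 1 := by
      rw [abs_le]; constructor <;> linarith [hs.1, hs.2, ht.1, ht.2]
    rw [sphereDist_spherePoint, zero_mul, add_zero, arccos_cos_sub, hst]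
    rw [hst]
    nlinarith
  have h01 := (hgeo 0 (by simp) 1 (by simp)).trans (show |(0 : ℝ) - 1| * b = b by norm_num)
  have hcmp := h.2 x p y η (by rwa [dist_comm y x]) hη (spherePoint _ _ _ hX)
    (spherePoint _ _ _ (hγ 0)) (spherePoint _ _ _ (hγ 1)) (fun t => spherePoint _ _ _ (hγ t))
    (by
      rw [sphereDist_spherePoint]
      simp only [zero_mul, Real.cos_zero, Real.sin_zero, mul_one, mul_zero, add_zero]
      exact Real.arccos_cos ha (by linarith))
    h01
    (by
      rw [sphereDist_spherePoint, dist_comm y x]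
      have : Real.cos (1 * b) * Real.cos a + Real.sin (1 * b) * w
          + 0 * √(Real.sin a ^ 2 - w ^ 2) = Real.cos c := by
        rw [one_mul]; linarith
      rw [this]
      exact Real.arccos_cos hc (by linarith))
    ⟨rfl, rfl, fun s hs t ht => by rw [h01]; exact hgeo s hs t ht⟩ s hs
  rw [sphereDist_spherePoint, mul_zero, add_zero] at hcmp
  exact hcmp

/-- Concavity of the sine: `sin v / v` decreases on `(0, π]`. -/
theorem mul_sin_le_mul_sin {u v : ℝ} (hu : 0 ≤ u) (huv : u ≤ v) (hv : v ≤ Real.pi) :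
    u * Real.sin v ≤ v * Real.sin u := by
  rcases (hu.trans huv).eq_or_lt with rfl | hv0
  · simp [le_antisymm huv hu]
  have hv' : v ∈ Set.Icc 0 Real.pi := ⟨hv0.le, hv⟩
  have h := strictConcaveOn_sin_Icc.concaveOn.2 hv' (Set.left_mem_Icc.2 Real.pi_pos.le)
    (div_nonneg hu hv0.le) (sub_nonneg.2 (div_le_one_of_le₀ huv hv0.le))
    (add_sub_cancel (u / v) 1)
  simp only [smul_eq_mul, mul_zero, add_zero, Real.sin_zero, div_mul_cancel₀ u hv0.ne'] at h
  rw [div_mul_eq_mul_div, div_le_iff₀ hv0] at h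
  linarith

/-- A quantitative form of the convexity of the squared distance in small spherical triangles. -/
theorem spherical_sq_dist_le {a b c : ℝ} (ha : 0 < a) (hb : 0 < b) (hc : 0 ≤ c) (ha1 : a ≤ 1)
    (hb1 : b ≤ 1) (hc1 : c ≤ 1) (hbac : b ≤ a + c) :
    -2 * a * b * (Real.cos c - Real.cos a * Real.cos b) / (Real.sin a * Real.sin b)
      ≤ c ^ 2 - b ^ 2 + 2 * a ^ 2 := by
  have hpi := Real.pi_gt_three
  have hsa : 0 < Real.sin a := Real.sin_pos_of_pos_of_lt_pi ha (by linarith)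
  have hsb : 0 < Real.sin b := Real.sin_pos_of_pos_of_lt_pi hb (by linarith)
  rw [div_le_iff₀ (by positivity)]
  have hcb : 0 ≤ Real.cos b := Real.cos_nonneg_of_mem_Icc ⟨by linarith, by linarith⟩
  -- Replacing `cos a cos b` by `cos b` reduces the claim to a bound on `cos b - cos c = 2 sin m sin
  -- e`, to be compared with `c² - b² = 4me`.
  have hcc : Real.cos a * Real.cos b ≤ Real.cos b :=
    mul_le_of_le_one_left hcb (Real.cos_le_one a)
  have hprod := Real.cos_sub_cos b c
  -- Introduced as opaque variables, so that the arithmetic treats `m` and `e` as atoms.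
  obtain ⟨m, hm⟩ : ∃ m, m = (b + c) / 2 := ⟨_, rfl⟩
  obtain ⟨e, he⟩ : ∃ e, e = (c - b) / 2 := ⟨_, rfl⟩
  have hsq : c ^ 2 - b ^ 2 = 4 * (m * e) := by rw [hm, he]; ring
  rw [← hm, show (b - c) / 2 = -e by rw [he]; ring, Real.sin_neg] at hprod
  have hm0 : 0 ≤ m := by linarith
  have hm1 : m ≤ 1 := by linarith
  suffices h : 4 * (a * b * (Real.sin m * Real.sin e))
      ≤ (4 * (m * e) + 2 * a ^ 2) * (Real.sin a * Real.sin b) by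
    rw [hsq]
    refine le_trans ?_ h
    have := mul_le_mul_of_nonneg_left hcc (by positivity : 0 ≤ a * b)
    have h2 : a * b * (Real.cos b - Real.cos c) = a * b * (2 * Real.sin m * Real.sin e) := by
      rw [hprod]; ring
    linarith
  rcases le_total 0 e with he0 | he0
  · have h3 := mul_sin_le_mul_sin hb.le (by linarith : b ≤ m) (by linarith)
    have h4 := Real.sin_le he0
    have h5 : b * Real.sin m * Real.sin e ≤ m * Real.sin b * e :=
      mul_le_mul h3 h4 (Real.sin_nonneg_of_nonneg_of_le_pi he0 (by linarith)) (by positivity)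
    -- For `e ≥ 0`, replacing `sin a` by `a` costs a cubic term; the summand `2a²` pays for it.
    have h6 := (Real.sin_gt_sub_cube ha).le
    have hme : m * e ≤ 1 * 1 := mul_le_mul hm1 (by linarith) he0 zero_le_one
    have ha2 : a ^ 2 ≤ 1 := pow_le_one₀ ha.le ha1
    have hme0 : 0 ≤ m * e := mul_nonneg hm0 he0
    have h7 : 4 * a * (m * e) ≤ (4 * (m * e) + 2 * a ^ 2) * Real.sin a := by
      refine le_trans ?_ (mul_le_mul_of_nonneg_left h6 (by positivity))
      have : 0 ≤ a ^ 3 * (12 - (4 * (m * e) + 2 * a ^ 2)) :=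
        mul_nonneg (by positivity) (by linarith)
      linarith
    have h8 := mul_le_mul_of_nonneg_right h7 hsb.le
    have h9 := mul_le_mul_of_nonneg_left h5 ha.le
    linarith
  · have h3 := mul_sin_le_mul_sin hm0 (by linarith : m ≤ b) (by linarith)
    have h4 := mul_sin_le_mul_sin (by linarith : 0 ≤ -e) (by linarith : -e ≤ a) (by linarith)
    have h5 : m * Real.sin b * (-e * Real.sin a) ≤ b * Real.sin m * (a * Real.sin (-e)) :=
      mul_le_mul h3 h4 (mul_nonneg (by linarith) hsa.le) (mul_nonneg hb.le
        (Real.sin_nonneg_of_nonneg_of_le_pi hm0 (by linarith)))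
    rw [Real.sin_neg] at h5
    have : 0 ≤ 2 * a ^ 2 * (Real.sin a * Real.sin b) := by positivity
    linarith

/-- The first variation needs only a majorant of `d²(x,·)` along the geodesic that agrees with it at
`p`. The squared comparison distance is one; its derivative at `0` is the left side of
`spherical_sq_dist_le`, whose `2a²` becomes the constant `2`. -/
theorem IsCATOne.localEVI {φ : X → EReal} (hbot : ∀ x, φ x ≠ ⊥) {lam : ℝ} (h : IsCATOne X)
    (hconv : IsGeodConvex φ lam) :
    LocalEVI (effDomain φ) (fun z => (φ z).toReal) |lam| 2 1 := by
  intro x hx τ hτ p hp y hy hxy hpy hxp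
  obtain ⟨η, hη, hηc⟩ := hconv p hp.1 y hy
  have hlam : -lam * (τ * dist p y ^ 2) ≤ |lam| * (τ * dist p y ^ 2) :=
    mul_le_mul_of_nonneg_right (neg_le_abs lam) (by positivity)
  rcases eq_or_ne p y with rfl | hne
  · simp only [dist_self, sub_self]
    nlinarith [sq_nonneg (dist x p)]
  have hb : 0 < dist p y := dist_pos.2 hne
  -- When `x = p` the comparison function is `arccos` near `1`, where it is not differentiable;
  -- `d²(x,·)` is then explicitly quadratic along the geodesic.
  rcases eq_or_ne x p with rfl | hnx
  · have := hp.variation hbot hτ hη.1 hη.2.1 hηc (G := fun s => (s * dist x y) ^ 2) (L := 0)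
      (fun s hs hs1 => by
        have := hη.2.2 0 (by simp) s ⟨hs.le, hs1⟩
        rw [hη.1, zero_sub, abs_neg, abs_of_pos hs] at this
        rw [this]) (by
        have hlim : Tendsto (fun s : ℝ => s * dist x y ^ 2) (𝓝[>] 0) (𝓝 (0 * dist x y ^ 2)) :=
          (Continuous.tendsto (by fun_prop) 0).mono_left nhdsWithin_le_nhds
        rw [zero_mul] at hlim
        refine hlim.congr' ?_
        filter_upwards [self_mem_nhdsWithin] with s hs
        have : s ≠ 0 := ne_of_gt hs
        rw [dist_self]
        field_simp
        ring)
    rw [dist_self]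
    linarith
  have ha : 0 < dist x p := dist_pos.2 hnx
  have hpi := Real.pi_gt_three
  have hper : dist x p + dist p y + dist y x < 2 * Real.pi := by
    rw [dist_comm y x]; linarith
  have hcmp := fun (s : ℝ) (hs : s ∈ Set.Icc (0 : ℝ) 1) => h.dist_le_arccos hη hb hper hs
  have htri := spherical_sq_dist_le ha hb dist_nonneg hxp.le hpy.le hxy.le
    (by rw [dist_comm x p]; exact dist_triangle p x y)
  set a := dist x p
  set b := dist p y
  set c := dist x y
  set w := (Real.cos c - Real.cos a * Real.cos b) / Real.sin b
  have hsina : 0 < Real.sin a := Real.sin_pos_of_pos_of_lt_pi ha (by linarith)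
  have hcos1 : Real.cos a ≠ 1 := fun hh => by
    nlinarith [Real.sin_sq_add_cos_sq a]
  have hcos2 : Real.cos a ≠ -1 := fun hh => by
    nlinarith [Real.sin_sq_add_cos_sq a]
  have hg : HasDerivAt (fun s : ℝ => Real.cos a * Real.cos (s * b) + w * Real.sin (s * b))
      (w * b) 0 := by
    have hid : HasDerivAt (fun s : ℝ => s * b) b 0 := by
      simpa using (hasDerivAt_id (0 : ℝ)).mul_const b
    have := (hid.cos.const_mul (Real.cos a)).fun_add (hid.sin.const_mul w)
    simpa using this
  have hG : HasDerivAt (fun s : ℝ => Real.arccos (Real.cos a * Real.cos (s * b)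
      + w * Real.sin (s * b)) ^ 2) (-2 * a * w * b / Real.sin a) 0 := by
    have hval : Real.cos a * Real.cos (0 * b) + w * Real.sin (0 * b) = Real.cos a := by simp
    have h1 : HasDerivAt Real.arccos (-(1 / √(1 - Real.cos a ^ 2)))
        (Real.cos a * Real.cos (0 * b) + w * Real.sin (0 * b)) := by
      rw [hval]; exact Real.hasDerivAt_arccos hcos2 hcos1
    have h2 := (h1.comp (0 : ℝ) hg).pow 2
    have hs : √(1 - Real.cos a ^ 2) = Real.sin a := by
      rw [← Real.sin_sq, Real.sqrt_sq hsina.le]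
    have harc : Real.arccos (Real.cos a) = a := Real.arccos_cos ha.le (by linarith)
    refine h2.congr_deriv ?_
    simp only [Function.comp, hval, hs, harc]
    field_simp
    ring
  have hL := hG.tendsto_slope_zero_right
  have hvar := hp.variation hbot hτ hη.1 hη.2.1 hηc
    (G := fun s => Real.arccos (Real.cos a * Real.cos (s * b) + w * Real.sin (s * b)) ^ 2)
    (fun s hs hs1 => by
      have := hcmp s ⟨hs.le, hs1⟩
      gcongr)
    (hL.congr fun s => by
      simp only [zero_add, zero_mul, Real.cos_zero, Real.sin_zero, mul_one, mul_zero, add_zero,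
        smul_eq_mul]
      rw [Real.arccos_cos ha.le (by linarith)]
      field_simp
      rfl)
  have hLeq : -2 * a * w * b / Real.sin a = -2 * a * b * (Real.cos c - Real.cos a * Real.cos b)
      / (Real.sin a * Real.sin b) := by
    simp only [w]
    field_simp
  rw [hLeq] at hvar
  linarith

end Spherical

/-! ### Slope bounds, stationary points and convergence of the energy. -/

section Slope

variable {X : Type*} [MetricSpace X] {φ : X → EReal}

theorem localSlope_le (hbot : ∀ x, φ x ≠ ⊥) {x : X} (hx : x ∈ effDomain φ) {c k : ℝ} (hc : 0 ≤ c)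
    (h : ∀ᶠ y in 𝓝 x, y ∈ effDomain φ →
      (φ x).toReal - (φ y).toReal ≤ c * dist x y + k * dist x y ^ 2) :
    localSlope φ x ≤ ENNReal.ofReal c := by
  rw [localSlope, if_neg hx]
  refine ENNReal.le_of_forall_pos_le_add fun ε hε _ => ?_
  refine limsup_le_of_le (by isBoundedDefault) ?_
  have hdist : Tendsto (fun y => k * dist x y) (𝓝 x) (𝓝 (k * dist x x)) :=
    Continuous.tendsto (by fun_prop) x
  rw [dist_self, mul_zero] at hdist
  have hsmall := hdist.eventually_lt_const (show (0 : ℝ) < ε from hε)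
  filter_upwards [nhdsWithin_le_nhds h, nhdsWithin_le_nhds hsmall] with y h1 h2
  refine ENNReal.div_le_of_le_mul ?_
  -- Off the domain `φ x - φ y = ⊥`, so the quotient is zero.
  by_cases hy : φ y = ⊤
  · simp [hy]
  · have hreal : φ x - φ y = (((φ x).toReal - (φ y).toReal : ℝ) : EReal) := by
      rw [EReal.coe_sub, EReal.coe_toReal hx (hbot x), EReal.coe_toReal hy (hbot y)]
    rw [hreal, EReal.toENNReal_of_ne_top (EReal.coe_ne_top _), EReal.toReal_coe, edist_dist,
      ← ENNReal.ofReal_coe_nnreal, ← ENNReal.ofReal_add hc ε.coe_nonneg,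
      ← ENNReal.ofReal_mul (by positivity)]
    refine ENNReal.ofReal_le_ofReal ((h1 hy).trans ?_)
    have := mul_le_mul_of_nonneg_right h2.le (dist_nonneg (x := x) (y := y))
    linarith

/-- A local quadratic lower bound at `x` becomes global by geodesic convexity. -/
theorem IsGeodConvex.sub_le (hbot : ∀ x, φ x ≠ ⊥) {lam : ℝ} (hconv : IsGeodConvex φ lam) {x z : X}
    (hx : x ∈ effDomain φ) (hz : z ∈ effDomain φ) {k : ℝ}
    (h : ∀ᶠ y in 𝓝 x, y ∈ effDomain φ → (φ x).toReal - (φ y).toReal ≤ k * dist x y ^ 2) :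
    (φ x).toReal - (φ z).toReal ≤ -lam / 2 * dist x z ^ 2 := by
  obtain ⟨γ, ⟨h0, h1, hgeo⟩, hγ⟩ := hconv x hx z hz
  have hd : ∀ s ∈ Set.Icc (0 : ℝ) 1, dist x (γ s) = s * dist x z := fun s hs => by
    have := hgeo 0 (by simp) s hs
    rwa [h0, zero_sub, abs_neg, abs_of_nonneg hs.1] at this
  have hlim : Tendsto (fun s : ℝ => s * dist x z) (𝓝[>] 0) (𝓝 (0 * dist x z)) :=
    (Continuous.tendsto (by fun_prop) 0).mono_left nhdsWithin_le_nhds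
  rw [zero_mul] at hlim
  have hIoo : ∀ᶠ s : ℝ in 𝓝[>] 0, s ∈ Set.Ioo (0 : ℝ) 1 := Ioo_mem_nhdsGT one_pos
  have hγlim : Tendsto γ (𝓝[>] 0) (𝓝 x) := by
    rw [tendsto_iff_dist_tendsto_zero]
    refine hlim.congr' ?_
    filter_upwards [hIoo] with s hs
    rw [dist_comm (γ s) x, hd s ⟨hs.1.le, hs.2.le⟩]
  -- Comparing the local bound at `γ s` with convexity and dividing by `s`, the local constant `k`
  -- keeps a factor `s` and is lost in the limit.
  have hlim2 : Tendsto (fun s : ℝ => -lam / 2 * (1 - s) * dist x z ^ 2 + k * s * dist x z ^ 2)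
      (𝓝[>] 0) (𝓝 (-lam / 2 * (1 - 0) * dist x z ^ 2 + k * 0 * dist x z ^ 2)) :=
    (Continuous.tendsto (by fun_prop) 0).mono_left nhdsWithin_le_nhds
  have := ge_of_tendsto hlim2 (b := (φ x).toReal - (φ z).toReal) (by
    filter_upwards [hIoo, hγlim.eventually h] with s hs hs'
    have hs01 : s ∈ Set.Icc (0 : ℝ) 1 := ⟨hs.1.le, hs.2.le⟩
    obtain ⟨hD, hle⟩ := hγ.toReal_le hbot hs01
    have h2 := hs' hD
    rw [hd s hs01] at h2
    rw [h0, h1] at hle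
    refine le_of_mul_le_mul_left ?_ hs.1
    linarith)
  simpa using this

/-- For `τ ≤ 1/(k+1)` the penalty `d²/(2τ)` strictly beats `k d²/2`, so `J_τ(x) = {x}`. Fine uniform
partitions give the constant curve, and any discrete solution of small mesh is constant. -/
theorem isStationaryPoint_of_sub_le (hbot : ∀ x, φ x ≠ ⊥) {x : X} (hx : x ∈ effDomain φ) {k : ℝ}
    (hk : 0 ≤ k)
    (h : ∀ z ∈ effDomain φ, (φ x).toReal - (φ z).toReal ≤ k / 2 * dist x z ^ 2) :
    IsStationaryPoint φ x := by
  have hk1 : 0 < k + 1 := by linarith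
  have hinv : ∀ τ : ℝ, 0 < τ → τ ≤ 1 / (k + 1) → k + 1 ≤ 1 / τ := fun τ h0 h1 => by
    rw [le_div_iff₀ h0]
    rw [le_div_iff₀ hk1] at h1
    linarith
  have hquad : ∀ τ z : ℝ, z / (2 * τ) = 1 / τ * z / 2 := fun τ z => by
    rcases eq_or_ne τ 0 with rfl | h0
    · simp
    · field_simp
  have hself : ∀ τ : ℝ, 0 < τ → τ ≤ 1 / (k + 1) → x ∈ minimizerSet φ τ x := by
    intro τ h0 h1
    refine le_antisymm (le_iInf fun z => ?_) (iInf_le _ x)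
    by_cases hz : φ z = ⊤
    · rw [hz, EReal.top_add_coe]; exact le_top
    · rw [← EReal.coe_toReal hx (hbot x), ← EReal.coe_toReal hz (hbot z), ← EReal.coe_add,
        ← EReal.coe_add, EReal.coe_le_coe_iff, hquad, hquad, dist_self]
      have h2 := mul_le_mul_of_nonneg_right (hinv τ h0 h1) (sq_nonneg (dist x z))
      have h3 := h z hz
      nlinarith [sq_nonneg (dist x z)]
  have huniq : ∀ τ : ℝ, 0 < τ → τ ≤ 1 / (k + 1) → ∀ p ∈ minimizerSet φ τ x, p = x := by
    intro τ h0 h1 p hp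
    have hstep := isProxStep_of_mem_minimizerSet hbot hx hp
    have h2 := hstep.2 x hx
    have h3 := h p hstep.1
    have h4 := mul_le_mul_of_nonneg_right (hinv τ h0 h1) (sq_nonneg (dist x p))
    rw [hquad, hquad, dist_self] at h2
    have h5 : dist x p ^ 2 ≤ 0 := by nlinarith
    have h6 : dist x p = 0 := pow_eq_zero_iff two_ne_zero |>.1 (le_antisymm h5 (sq_nonneg _))
    exact (dist_eq_zero.1 h6).symm
  refine ⟨hx, ?_, ?_⟩
  · have hdiff : ∀ i k' : ℕ, ((k' + 1 : ℕ) : ℝ) * (1 / (k + 1) / ((i : ℝ) + 1))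
        - k' * (1 / (k + 1) / ((i : ℝ) + 1)) = 1 / (k + 1) / ((i : ℝ) + 1) := fun i k' => by
      push_cast; ring
    have hpos : ∀ i : ℕ, 0 < 1 / (k + 1) / ((i : ℝ) + 1) := fun i => by positivity
    refine ⟨fun i j => j * (1 / (k + 1) / ((i : ℝ) + 1)), fun _ _ => x, fun i => ?_, ?_, ?_⟩
    · refine ⟨by simp, fun a b hab => ?_, ?_, rfl, fun j => ?_⟩
      · exact mul_lt_mul_of_pos_right (by exact_mod_cast hab) (hpos i)
      · exact tendsto_natCast_atTop_atTop.atTop_mul_const (hpos i)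
      · change x ∈ minimizerSet φ (((j + 1 : ℕ) : ℝ) * _ - j * _) x
        rw [hdiff]
        exact hself _ (hpos i) (div_le_self (by positivity) (by
          have : (0 : ℝ) ≤ i := Nat.cast_nonneg i
          linarith))
    · intro ε hε
      have hlim : Tendsto (fun i : ℕ => 1 / (k + 1) / ((i : ℝ) + 1)) atTop (𝓝 0) := by
        have := (tendsto_one_div_add_atTop_nhds_zero_nat (𝕜 := ℝ)).const_mul (1 / (k + 1))
        rw [mul_zero] at this
        exact this.congr fun i => by rw [mul_one_div]
      filter_upwards [hlim.eventually_lt_const hε] with i hi j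
      rw [hdiff]
      exact hi.le
    · exact fun s _ => tendsto_const_nhds
  · rintro ζ ⟨t, y, hsol, hmesh, hlim⟩ s hs
    refine tendsto_nhds_unique (hlim s hs) (tendsto_const_nhds.congr' ?_)
    filter_upwards [hmesh (1 / (k + 1)) (by positivity)] with i hi
    obtain ⟨-, hmono, -, hy0, hstep⟩ := hsol i
    have hconst : ∀ j, y i j = x := by
      intro j
      induction j with
      | zero => exact hy0
      | succ j ih =>
        have := hstep j
        rw [ih] at this
        exact huniq _ (sub_pos.2 (hmono (Nat.lt_succ_self j))) (hi j) _ this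
    exact (hconst _).symm

theorem LowerSemicontinuous.isClosed_toReal_le (hbot : ∀ x, φ x ≠ ⊥)
    (hlsc : LowerSemicontinuous φ) (M : ℝ) :
    IsClosed {z | z ∈ effDomain φ ∧ (φ z).toReal ≤ M} := by
  convert hlsc.isClosed_preimage (M : EReal) using 1
  ext z
  constructor
  · rintro ⟨h1, h2⟩
    rw [Set.mem_preimage, Set.mem_Iic, ← EReal.coe_toReal h1 (hbot z)]
    exact_mod_cast h2
  · intro hz
    have hz' : φ z ≤ M := hz
    have h1 : φ z ≠ ⊤ := (hz'.trans_lt (EReal.coe_lt_top _)).ne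
    refine ⟨h1, ?_⟩
    rw [← EReal.coe_toReal h1 (hbot z)] at hz'
    exact_mod_cast hz'

theorem IsDiscreteSolution.isProxSequence (hbot : ∀ x, φ x ≠ ⊥) {x₀ : X}
    (hx₀ : x₀ ∈ effDomain φ) {t : ℕ → ℝ} {x : ℕ → X} (h : IsDiscreteSolution φ x₀ t x) :
    IsProxSequence (effDomain φ) (fun z => (φ z).toReal) t x := by
  obtain ⟨ht0, hmono, htop, h0, hstep⟩ := h
  have hmem : ∀ k, x k ∈ effDomain φ := by
    intro k
    induction k with
    | zero => rwa [h0]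
    | succ k ih => exact (isProxStep_of_mem_minimizerSet hbot ih (hstep k)).1
  exact ⟨ht0, hmono, htop, hmem, fun k => isProxStep_of_mem_minimizerSet hbot (hmem k) (hstep k)⟩

theorem IsGradientCurve.isEVICurve (hbot : ∀ x, φ x ≠ ⊥) (hlsc : LowerSemicontinuous φ) {x₀ : X}
    (hx₀ : x₀ ∈ effDomain φ) {ξ : ℝ → X} (hξ : IsGradientCurve φ x₀ ξ) {κ K r₀ : ℝ} (hr : 0 < r₀)
    (hE : LocalEVI (effDomain φ) (fun z => (φ z).toReal) κ K r₀) (hκ : 0 ≤ κ) (hK : 0 ≤ K) :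
    IsEVICurve (effDomain φ) (fun z => (φ z).toReal) (φ x₀).toReal κ r₀ ξ := by
  obtain ⟨t, x, hsol, hmesh, hlim⟩ := hξ
  have hseq := fun i => (hsol i).isProxSequence hbot hx₀
  have h : IsProxLimit (effDomain φ) (fun z => (φ z).toReal) (φ x₀).toReal atTop t x ξ :=
    ⟨hseq, hmesh, fun i k => by
      have := (hseq i).antitone (Nat.zero_le k)
      simpa only [(hsol i).2.2.2.1] using this, hlim⟩
  exact h.isEVICurve (hlsc.isClosed_toReal_le hbot) hr hE hκ hK

theorem IsEVICurve.exists_tendsto {D : Set X} {f : X → ℝ} {B κ r₀ : ℝ} {u : ℝ → X}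
    (h : IsEVICurve D f B κ r₀ u) {c : ℝ} (hc : ∀ᶠ t in atTop, c ≤ f (u t)) :
    ∃ G, Tendsto (fun t => f (u t)) atTop (𝓝 G) := by
  -- Truncation at `0`, since the curve is controlled only for nonnegative times.
  have hanti : Antitone fun t : ℝ => f (u (max t 0)) := fun s t hst =>
    h.anti _ _ (le_max_right _ _) (max_le_max hst le_rfl)
  have hbdd : BddBelow (Set.range fun t : ℝ => f (u (max t 0))) := by
    refine ⟨c, ?_⟩
    rintro _ ⟨t, rfl⟩
    obtain ⟨s, hs, hts, h0⟩ := (hc.and ((eventually_ge_atTop t).and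
      (eventually_ge_atTop 0))).exists
    exact hs.trans (h.anti _ _ (le_max_right _ _) (max_le hts h0))
  refine ⟨_, (tendsto_atTop_ciInf hanti hbdd).congr' ?_⟩
  filter_upwards [eventually_ge_atTop 0] with t ht
  rw [max_eq_left ht]

theorem tendsto_sqrt_drop {g : ℝ → ℝ} {G : ℝ} (hg : Tendsto g atTop (𝓝 G)) (ℓ : ℝ) :
    Tendsto (fun t => 2 * √((g (t - ℓ) - g t) / ℓ)) atTop (𝓝 0) := by
  have h1 : Tendsto (fun t => g (t - ℓ)) atTop (𝓝 G) :=
    hg.comp (tendsto_atTop_add_const_right _ (-ℓ) tendsto_id)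
  simpa using ((((h1.sub hg).div_const ℓ).sqrt).const_mul 2)

end Slope

/-! ### The two assertions. -/

theorem theorem4p9 {X : Type*} [MetricSpace X] [CompleteSpace X]
    (φ : X → EReal) (hbot : ∀ x, φ x ≠ ⊥) (hlsc : LowerSemicontinuous φ) (lam : ℝ)
    (hcase : CaseCATOne φ lam ∨ CaseCommutative φ lam)
    (x₀ : X) (hx₀ : x₀ ∈ effDomain φ) (ξ : ℝ → X) (hξ : IsGradientCurve φ x₀ ξ) :
    ((∃ c : ℝ, ∀ᶠ t in atTop, (c : EReal) ≤ φ (ξ t)) →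
      Tendsto (fun t => localSlope φ (ξ t)) atTop (𝓝 0)) ∧
    (∀ (u : ℕ → ℝ) (y : X), Tendsto u atTop atTop →
      Tendsto (fun n => ξ (u n)) atTop (𝓝 y) →
      localSlope φ y = 0 ∧ IsStationaryPoint φ y ∧
        Tendsto (fun t => φ (ξ t)) atTop (𝓝 (φ y))) := by
  have hconv : IsGeodConvex φ lam := hcase.elim (fun h => h.2) fun h => h.isGeodConvex
  obtain ⟨K, hK, hE⟩ : ∃ K, 0 ≤ K ∧
      LocalEVI (effDomain φ) (fun z => (φ z).toReal) |lam| K 1 :=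
    hcase.elim (fun h => ⟨2, zero_le_two, h.1.localEVI hbot h.2⟩) fun h => h.localEVI hbot
  have hcurve := hξ.isEVICurve hbot hlsc hx₀ one_pos hE (abs_nonneg lam) hK
  obtain ⟨ℓ, hℓ, hℓκ⟩ : ∃ ℓ : ℝ, 0 < ℓ ∧ 4 * |lam| * ℓ ≤ 1 := by
    -- The added `1` also covers `lam = 0`.
    refine ⟨1 / (4 * (|lam| + 1)), by positivity, ?_⟩
    rw [mul_one_div, div_le_one (by positivity)]
    linarith
  have hsub := fun (t : ℝ) (ht : ℓ ≤ t) (y : X) (hy : y ∈ effDomain φ) (hd : dist (ξ t) y < 1) =>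
    hcurve.sub_le (abs_nonneg lam) one_pos hℓ hℓκ ht hy hd
  have hreal : ∀ t, 0 ≤ t → (((φ (ξ t)).toReal : ℝ) : EReal) = φ (ξ t) := fun t ht =>
    EReal.coe_toReal (hcurve.mem t ht) (hbot _)
  refine ⟨?_, ?_⟩
  · rintro ⟨c, hc⟩
    have hc' : ∀ᶠ t in atTop, c ≤ (φ (ξ t)).toReal := by
      filter_upwards [hc, eventually_ge_atTop 0] with t h1 h2
      rw [← hreal t h2] at h1
      exact_mod_cast h1
    obtain ⟨G, hG⟩ := hcurve.exists_tendsto hc'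
    have hlim := ENNReal.tendsto_ofReal (tendsto_sqrt_drop hG ℓ)
    rw [ENNReal.ofReal_zero] at hlim
    refine tendsto_of_tendsto_of_tendsto_of_le_of_le' tendsto_const_nhds hlim
      (Eventually.of_forall fun _ => zero_le) ?_
    filter_upwards [eventually_ge_atTop ℓ] with t ht
    refine localSlope_le hbot (hcurve.mem t (hℓ.le.trans ht)) (by positivity) (k := |lam| / 2) ?_
    filter_upwards [Metric.ball_mem_nhds (ξ t) one_pos] with y hy hyD
    exact hsub t ht y hyD (by rwa [dist_comm])
  · intro u y hu hy
    have hcl := hlsc.isClosed_toReal_le hbot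
    -- Closed sublevel sets and monotonicity bound the energy below by its value at `y`, so the
    -- existence of a limit point already forces convergence of the energy.
    have hle : ∀ t, 0 ≤ t → y ∈ effDomain φ ∧ (φ y).toReal ≤ (φ (ξ t)).toReal := fun t ht =>
      (hcl _).mem_of_tendsto hy (by
        filter_upwards [hu.eventually_ge_atTop t] with n hn
        exact ⟨hcurve.mem _ (ht.trans hn), hcurve.anti _ _ ht hn⟩)
    have hyD := (hle 0 le_rfl).1
    obtain ⟨G, hG⟩ := hcurve.exists_tendsto (c := (φ y).toReal) (by
      filter_upwards [eventually_ge_atTop 0] with t ht using (hle t ht).2)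
    have hyG : (φ y).toReal ≤ G := ge_of_tendsto hG (by
      filter_upwards [eventually_ge_atTop 0] with t ht using (hle t ht).2)
    have hlim : ∀ z ∈ effDomain φ, dist y z < 1 →
        G - (φ z).toReal ≤ |lam| / 2 * dist y z ^ 2 := by
      intro z hz hyz
      have hd := hy.dist (tendsto_const_nhds (x := z))
      have h1 := (hG.comp hu).sub_const (φ z).toReal
      have h2 := (((tendsto_sqrt_drop hG ℓ).comp hu).mul hd).add ((hd.pow 2).const_mul (|lam| / 2))
      rw [zero_mul, zero_add] at h2
      refine le_of_tendsto_of_tendsto h1 h2 ?_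
      filter_upwards [hu.eventually_ge_atTop ℓ, hd.eventually_lt_const hyz] with n hn hn'
      exact hsub (u n) hn z hz hn'
    -- The choice `z = y` gives `G ≤ φ y`, the inequality that lower semicontinuity does not supply.
    have hGy : G = (φ y).toReal := by
      have := hlim y hyD (by simp)
      rw [dist_self] at this
      refine le_antisymm ?_ hyG
      linarith [mul_zero (|lam| / 2), this.trans_eq (by ring : |lam| / 2 * (0 : ℝ) ^ 2 = 0)]
    have hloc : ∀ᶠ z in 𝓝 y, z ∈ effDomain φ →
        (φ y).toReal - (φ z).toReal ≤ |lam| / 2 * dist y z ^ 2 := by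
      filter_upwards [Metric.ball_mem_nhds y one_pos] with z hz hzD
      rw [← hGy]
      exact hlim z hzD (by rwa [dist_comm])
    refine ⟨?_, ?_, ?_⟩
    · refine le_antisymm ?_ zero_le
      have := localSlope_le hbot hyD le_rfl (k := |lam| / 2) (by
        filter_upwards [hloc] with z hz hzD
        rw [zero_mul, zero_add]
        exact hz hzD)
      rwa [ENNReal.ofReal_zero] at this
    · refine isStationaryPoint_of_sub_le hbot hyD (abs_nonneg lam) fun z hz => ?_
      refine (hconv.sub_le hbot hyD hz hloc).trans ?_
      have := neg_le_abs lam
      gcongr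
    · rw [← EReal.coe_toReal hyD (hbot y), ← hGy]
      refine (EReal.tendsto_coe.2 hG).congr' ?_
      filter_upwards [eventually_ge_atTop 0] with t ht using hreal t ht
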